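/- Let $G$ be a (finite-dimensional, real) local Lie group with unit $e$, Lie algebra $\mathfrak g=T_eG$, bracket $[\cdot,\cdot]$ and exponential map $\exp$. Let $H$ be a local closed (embedded) Lie subgroup of $G$ with Lie algebra $\mathfrak h$, and let $Q$ be a smooth submanifold through $e$, transversal to $H$, which is a section of the left cosets of $H$ near $e$; put $V=T_eQ$, so that $\mathfrak g=V\oplus\mathfrak h$, and let $\Pi:\mathfrak g\to V$ be the projection parallel to $\mathfrak h$. Near $0$ let $\varphi:V\to\mathfrak h$ be the map with $\varphi(0)=0$ and $\exp(\xi+\varphi(\xi))\in Q$, and let $R:V\times V\to\mathfrak h$ be the symmetric bilinear map with $\varphi(\xi)=R(\xi,\xi)+O(|\xi|^3)$. Use $x\in V$ as the coordinate of the point $\exp(x+\varphi(x))$ of $Q$. The projection of $G$ on $Q$ parallel to $H$ ($g=qh\mapsto q$) gives the local loop $x\times y=\Pi_Q(x\cdot y)$ on $Q$; write $\mu(x,y)\in V$ for it in coordinates. On $Q\times Q$ near $(e,e)$ consider the 3-web $x=\mathrm{const}$, $y=\mathrm{const}$, $\mu(x,y)=\mathrm{const}$, with the forms $\omega_1^i=\frac{\partial\mu^i}{\partial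 x^\alpha}dx^\alpha$, $\omega_2^i=\frac{\partial\mu^i}{\partial y^\beta}dy^\beta$, and its Chern connection $\omega^k_j=\Gamma^k_{ij}\omega_1^i+\Gamma^k_{jl}\omega_2^l$, where $\Gamma^k_{ij}=-\widetilde P^\alpha_i\widetilde Q^\beta_j\frac{\partial^2\mu^k}{\partial x^\alpha\partial y^\beta}$ and $\widetilde P,\widetilde Q$ are the inverses of the matrices $(\partial\mu^i/\partial x^\alpha)$, $(\partial\mu^i/\partial y^\beta)$. Its torsion tensor is $a^k_{ij}=\Gamma^k_{[ij]}$, and its curvature tensor $b$ is defined by $d\omega^k_j=\omega^i_j\wedge\omega^k_i+b^k_{jlm}\,\omega_1^l\wedge\omega_2^m$. Let $\overset{2}{\nabla}_m$ be the component along $\omega_2^m$ of the covariant derivative for this connection. Put $a(\xi,\eta)=a^i_{jk}\xi^j\eta^k$ and $b(\xi,\eta,\zeta)=b^i_{jkl}\xi^j\eta^k\zeta^l$ at $(e,e)$, and $$d(\xi,\eta,\zeta,\tau)=d^i_{jklm}\xi^j\eta^k\zeta^l\tau^m=\overset{2}{\nabla}_m b^i_{jkl}\Big|_{(e,e)}\xi^j\eta^k\zeta^l\tau^m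 .$$ For $u\in G$ near $e$ let $b''_u$ be the value at $(e,e)$ of the curvature tensor of the loop on $Q$ defined in the same way by the projection on $Q$ parallel to $uHu^{-1}$ in place of $H$. Then $\mu$ is smooth near $(0,0)$, and for all $\xi,\eta,\zeta,\tau\in V$ $$\begin{aligned} d(\xi,\eta,\zeta,\tau)&=\frac{d}{dt}\,b''_{\exp t\tau}(\xi,\eta,\zeta)\Big|_{t=0}\\ &=\tfrac12\Pi[\tau,[[\xi,\eta],\zeta]]-\tfrac12\Pi[\tau,\Pi[[\xi,\eta],\zeta]]-\tfrac12\Pi[\tau,[\Pi[\xi,\eta],\zeta]]+\tfrac12\Pi[\tau,\Pi[\Pi[\xi,\eta],\zeta]]\\ &\quad-\tfrac12\Pi[\Pi[\tau,[\xi,\eta]],\zeta]+\tfrac12\Pi[\Pi[\tau,\Pi[\xi,\eta]],\zeta]+2\Pi[\tau,[R(\xi,\eta),\zeta]]\\ &\quad-2\Pi[\tau,\Pi[R(\xi,\eta),\zeta]]-2\Pi[\Pi[\tau,R(\xi,\eta)],\zeta], \end{aligned}$$ the derivative on the right of the first equality being claimed to exist. Moreover $d^i_{jk[lm]}=-b^i_{jkp}a^p_{lm}$,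 that is, $$\tfrac12\big(d(\xi,\eta,\zeta,\tau)-d(\xi,\eta,\tau,\zeta)\big)=-b(\xi,\eta,a(\zeta,\tau)).$$ -/

import Mathlib

open scoped ContDiff Topology

noncomputable section

/-! ### Three-webs of a local product and the Chern connection

`f : W × W → W` is a smooth product near a point (in a coordinate space `W`). The web on `W × W`
has the leaves `x = const`, `y = const`, `f (x, y) = const`, and the basic forms
`ω₁ = P dx`, `ω₂ = Q dy` with `P = ∂f/∂x`, `Q = ∂f/∂y`. -/

section Web

variable {W : Type*} [NormedAddCommGroup W] [NormedSpace ℝ W]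

/-- `P = ∂f/∂x` at `p = (x, y)`. -/
def webP (f : W × W → W) (p : W × W) : W →L[ℝ] W := fderiv ℝ (fun x => f (x, p.2)) p.1

/-- `Q = ∂f/∂y` at `p = (x, y)`. -/
def webQ (f : W × W → W) (p : W × W) : W →L[ℝ] W := fderiv ℝ (fun y => f (p.1, y)) p.2

/-- The mixed second derivative `∂²f/∂x∂y`; the first argument is the `x`-direction. -/
def webMixed (f : W × W → W) (p : W × W) : W →L[ℝ] W →L[ℝ] W :=
  fderiv ℝ (fun x => webQ f (x, p.2)) p.1

/-- `Γ^k_{ij} ξ^i η^j = - (∂²f^k/∂x^α∂y^β) (P⁻¹ξ)^α (Q⁻¹η)^β`. -/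
def chernGamma (f : W × W → W) (p : W × W) (ξ η : W) : W :=
  -webMixed f p ((webP f p).inverse ξ) ((webQ f p).inverse η)

/-- The connection form `ω^k_j = Γ^k_{ij} ω₁^i + Γ^k_{jl} ω₂^l`, evaluated at the tangent vector
`X` at `p` and applied to `ζ`: this is `ω^k_j(X) ζ^j`. -/
def chernForm (f : W × W → W) (p X : W × W) (ζ : W) : W :=
  chernGamma f p (webP f p X.1) ζ + chernGamma f p ζ (webQ f p X.2)

/-- The curvature form `dω^k_j - ω^i_j ∧ ω^k_i`, evaluated at `(X, Y)` and applied to `ζ`. -/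
def chernCurv (f : W × W → W) (p X Y : W × W) (ζ : W) : W :=
  fderiv ℝ (fun p' => chernForm f p' Y ζ) p X - fderiv ℝ (fun p' => chernForm f p' X ζ) p Y
    + chernForm f p X (chernForm f p Y ζ) - chernForm f p Y (chernForm f p X ζ)

/-- The torsion tensor `a^k_{ij} ξ^i η^j = Γ^k_{[ij]} ξ^i η^j`. -/
def webA (f : W × W → W) (p : W × W) (ξ η : W) : W :=
  (1 / 2 : ℝ) • (chernGamma f p ξ η - chernGamma f p η ξ)

/-- The curvature tensor `b^k_{jlm} ξ^j η^l ζ^m`, where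
`dω^k_j = ω^i_j ∧ ω^k_i + b^k_{jlm} ω₁^l ∧ ω₂^m`. -/
def webB (f : W × W → W) (p : W × W) (ξ η ζ : W) : W :=
  chernCurv f p ((webP f p).inverse η, 0) (0, (webQ f p).inverse ζ) ξ

/-- `(∇²_m b^i_{jkl}) ξ^j η^k ζ^l τ^m`: the covariant derivative of the tensor field `b` for the
Chern connection, in the direction `Y` with `ω₁(Y) = 0` and `ω₂(Y) = τ`. -/
def webNablaTwoB (f : W × W → W) (p : W × W) (ξ η ζ τ : W) : W :=
  let Y : W × W := (0, (webQ f p).inverse τ)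
  fderiv ℝ (fun p' => webB f p' ξ η ζ) p Y + chernForm f p Y (webB f p ξ η ζ)
    - webB f p (chernForm f p Y ξ) η ζ - webB f p ξ (chernForm f p Y η) ζ
    - webB f p ξ η (chernForm f p Y ζ)

end Web

/-! ### Local Lie groups -/

/-- A local Lie group, in a chart with values in `E` that sends the unit to `0`. The operations
matter only near `0`; their values elsewhere are irrelevant. -/
structure LocalLieGroup (E : Type*) [NormedAddCommGroup E] [NormedSpace ℝ E] where
  mul : E → E → E
  inv : E → E
  smooth_mul : ∀ᶠ p in 𝓝 (0 : E × E), ContDiffAt ℝ ∞ (fun p : E × E => mul p.1 p.2) p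
  smooth_inv : ∀ᶠ x in 𝓝 (0 : E), ContDiffAt ℝ ∞ inv x
  one_mul : ∀ᶠ x in 𝓝 (0 : E), mul 0 x = x
  mul_one : ∀ᶠ x in 𝓝 (0 : E), mul x 0 = x
  mul_assoc : ∀ᶠ p in 𝓝 (0 : E × E × E),
    mul (mul p.1 p.2.1) p.2.2 = mul p.1 (mul p.2.1 p.2.2)
  inv_zero : inv 0 = 0
  inv_mul : ∀ᶠ x in 𝓝 (0 : E), mul (inv x) x = 0
  mul_inv : ∀ᶠ x in 𝓝 (0 : E), mul x (inv x) = 0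

section LocalGroup

variable {E : Type*} [NormedAddCommGroup E] [NormedSpace ℝ E]

/-- `S` is, near `0 ∈ S`, an embedded smooth submanifold with tangent space `W` at `0`: a slice
chart `Ψ`, normalized by `dΨ₀ = id`, carries `S` to `W`. -/
def IsSubmanifoldAtZero (S : Set E) (W : Submodule ℝ E) : Prop :=
  ∃ Ψ : E → E, (∀ᶠ x in 𝓝 (0 : E), ContDiffAt ℝ ∞ Ψ x) ∧ Ψ 0 = 0 ∧
    HasFDerivAt Ψ (ContinuousLinearMap.id ℝ E) 0 ∧ ∀ᶠ x in 𝓝 (0 : E), x ∈ S ↔ Ψ x ∈ W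

namespace LocalLieGroup

variable (G : LocalLieGroup E)

/-- The Lie bracket on the tangent space `E` at the unit: the antisymmetric part of the second
order term `β` of `x · y = x + y + β(x, y) + …`, that is `[X, Y] = β(X, Y) - β(Y, X)`. -/
def bracket (X Y : E) : E :=
  fderiv ℝ (fun x => fderiv ℝ (fun y => G.mul x y) 0 Y) 0 X
    - fderiv ℝ (fun x => fderiv ℝ (fun y => G.mul x y) 0 X) 0 Y

/-- `e` is the exponential map of `G` near `0`: it is smooth, and each `t ↦ e (t x)` is the
one-parameter subgroup with velocity `x`. -/
def IsExp (e : E → E) : Prop :=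
  (∀ᶠ x in 𝓝 (0 : E), ContDiffAt ℝ ∞ e x) ∧ e 0 = 0 ∧
    HasFDerivAt e (ContinuousLinearMap.id ℝ E) 0 ∧
    ∀ᶠ x in 𝓝 (0 : E), ∀ s ∈ Set.Icc (-1 : ℝ) 1, ∀ t ∈ Set.Icc (-1 : ℝ) 1,
      e ((s + t) • x) = G.mul (e (s • x)) (e (t • x))

/-- `H` is a local (closed, embedded) Lie subgroup of `G` with tangent space `h` at the unit. -/
def IsLocalSubgroup (H : Set E) (h : Submodule ℝ E) : Prop :=
  IsSubmanifoldAtZero H h ∧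
    (∀ᶠ p in 𝓝 (0 : E × E), p.1 ∈ H → p.2 ∈ H → G.mul p.1 p.2 ∈ H) ∧
    ∀ᶠ x in 𝓝 (0 : E), x ∈ H → G.inv x ∈ H

/-- The conjugate subgroup `u H u⁻¹`, described near the unit as `{x | u⁻¹ x u ∈ H}`. -/
def conjSubgroup (H : Set E) (u : E) : Set E := {x | G.mul (G.mul (G.inv u) x) u ∈ H}

end LocalLieGroup

/-! ### The section `Q` and its loop -/

/-- `φ : V → h` is the map with `exp (ξ + φ ξ) ∈ Q` and small values for small `ξ`; this
determines `φ` near `0`. -/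
def IsSectionMap (exp : E → E) (Q : Set E) (V h : Submodule ℝ E) (φ : V → h) : Prop :=
  φ 0 = 0 ∧ ContinuousAt φ 0 ∧ ∀ᶠ ξ : V in 𝓝 (0 : V), exp ((ξ : E) + (φ ξ : E)) ∈ Q

/-- The map `φ` (its germ at `0` is the one determined by `IsSectionMap`). -/
def sectionMap (exp : E → E) (Q : Set E) (V h : Submodule ℝ E) : V → h :=
  Classical.epsilon (IsSectionMap exp Q V h)

/-- The symmetric bilinear map `R : V × V → h` in `φ(ξ) = R(ξ, ξ) + S(ξ, ξ, ξ) + o(3)`. -/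
def sectionR (exp : E → E) (Q : Set E) (V h : Submodule ℝ E) (ξ η : V) : h :=
  (1 / 2 : ℝ) • fderiv ℝ (fderiv ℝ (sectionMap exp Q V h)) 0 ξ η

/-- The point of `Q` with coordinate `x ∈ V`: `exp (x + φ x)`. -/
def sectionPoint (exp : E → E) (Q : Set E) (V h : Submodule ℝ E) (x : V) : E :=
  exp ((x : E) + (sectionMap exp Q V h x : E))

/-- `π : G → V` gives the coordinate of the projection of `G` on a section `q : V → G` parallel to
the subgroup `K`: `g ∈ q(π g) K`, with small values for small `g`; this determines `π` near the
unit. -/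
def IsCosetProj (G : LocalLieGroup E) (K : Set E) {V : Submodule ℝ E} (q : V → E) (π : E → V) :
    Prop :=
  π 0 = 0 ∧ ContinuousAt π 0 ∧ ∀ᶠ g in 𝓝 (0 : E), G.mul (G.inv (q (π g))) g ∈ K

/-- The coordinate of the projection on the section `q` parallel to `K`. -/
def cosetProj (G : LocalLieGroup E) (K : Set E) {V : Submodule ℝ E} (q : V → E) : E → V :=
  Classical.epsilon (IsCosetProj G K q)

/-- The product on the section `q`, in coordinates: `(x, y)` goes to the coordinate of the
projection of `q x · q y` on the section parallel to `K`. -/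
def loopLaw (G : LocalLieGroup E) (K : Set E) {V : Submodule ℝ E} (q : V → E) (p : V × V) : V :=
  cosetProj G K q (G.mul (q p.1) (q p.2))

end LocalGroup

/-- The setting: a local Lie group `G` with exponential map `exp`, a local closed subgroup `H` with
tangent space `h`, and a smooth section `Q` of the left cosets `G mod H` through the unit, with
tangent space `V`, transversal to `H`. -/
structure LoopInGroup (E : Type*) [NormedAddCommGroup E] [NormedSpace ℝ E] where
  G : LocalLieGroup E
  exp : E → E
  isExp : G.IsExp exp
  H : Set E
  h : Submodule ℝ E
  isLocalSubgroup : G.IsLocalSubgroup H h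
  Q : Set E
  V : Submodule ℝ E
  isSubmanifold : IsSubmanifoldAtZero Q V
  isCompl : IsCompl V h

namespace LoopInGroup

variable {E : Type*} [NormedAddCommGroup E] [NormedSpace ℝ E] (S : LoopInGroup E)

/-- The Lie bracket of the Lie algebra of `G`. -/
def br (x y : E) : E := S.G.bracket x y

/-- The projection of the Lie algebra on `V` parallel to `h`. -/
def Pr (x : E) : E := S.V.projectionOnto S.h S.isCompl x

/-- The bilinear map `R` with `exp (ξ + R(ξ, ξ) + …) ∈ Q`. -/
def R (ξ η : S.V) : E := sectionR S.exp S.Q S.V S.h ξ η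

/-- The point of `Q` with coordinate `x`. -/
def point (x : S.V) : E := sectionPoint S.exp S.Q S.V S.h x

/-- The loop law of `Q`, in the coordinates of `V`. -/
def law : S.V × S.V → S.V := loopLaw S.G S.H S.point

/-- The loop law on `Q` given by the projection parallel to `u H u⁻¹`. -/
def lawConj (u : E) : S.V × S.V → S.V := loopLaw S.G (S.G.conjSubgroup S.H u) S.point

/-- The structure tensor `a` of the loop: the torsion tensor of its web at `(e, e)`. -/
def a (ξ η : S.V) : S.V := webA S.law 0 ξ η

/-- The structure tensor `b` of the loop: the curvature tensor of its web at `(e, e)`. -/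
def b (ξ η ζ : S.V) : S.V := webB S.law 0 ξ η ζ

/-- The structure tensor `d = ∇² b` at `(e, e)`. -/
def d (ξ η ζ τ : S.V) : S.V := webNablaTwoB S.law 0 ξ η ζ τ

/-- The structure tensor `b` of the loop on `Q` given by the projection parallel to `u H u⁻¹`. -/
def bConj (u : E) (ξ η ζ : S.V) : S.V := webB (S.lawConj u) 0 ξ η ζ

end LoopInGroup

end

open scoped ContDiff Topology
open Filter

/-! ### Derivatives, invertibility of nearby operators, and a smooth implicit function theorem -/

section Calculus

variable {E F V P : Type*} [NormedAddCommGroup E] [NormedSpace ℝ E]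
  [NormedAddCommGroup F] [NormedSpace ℝ F] [NormedAddCommGroup V] [NormedSpace ℝ V]
  [NormedAddCommGroup P] [NormedSpace ℝ P]

/-! Near `e` the section `Q` is a model of the space of left cosets of `H`, so `G` acts on it
locally by `ρ(g, y) = Π_Q(g·y)`, and the loop law is `x × y = ρ(q x, y)`, where `q` is the
parametrized section (`actLaw`). Write `L_y : 𝔤 → V` for the infinitesimal action at `y`, `ι = dq₀`
for the inclusion of `V`, `β` for the second order term of the product, and `Π_y = (L_y ι)⁻¹ L_y`
for the projection on `V` parallel to the isotropy algebra of `y`.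

On the line `x = 0` one has `0 × y = y`, so `∂μ/∂y = id` and `∂μ/∂x = L_y ι`. There the curvature
reduces to the derivative of a vector field (`webB_eq_fderiv`). With `w(ξ,η) = q''(ξ,η) - β(ιη,ιξ)`,
that field is, up to sign, the fundamental field of `A = w - ιΠ_y w`, which vanishes at `y`; its
derivative along another fundamental field is therefore just a bracket. This gives `b(L_y ιξ, L_y
ιη, L_y ιζ) = -L_y[A, ιζ]` (`webB_actLaw`).

At the origin the covariant derivatives of the fields `y ↦ L_y ιξ` in the `ω₂` directions vanish.
Hence `d` is the ordinary derivative, along `τ`, of `-Π_y[w - ιΠ_y w, ιζ]`. Replacing `H` by `uHu⁻¹`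
keeps the section and `w`, and changes only the projection, which becomes the one parallel to the
isotropy algebra of the coset `uH` (`fderiv_conjProj`, `bConj_eq`). So `d` and the derivative of
`b''` along `exp tτ` differentiate the same expression. The explicit formula follows from `dΠ(τ)v =
Π[v - Πv, τ]` (`fderiv_actProj`) and `w = ½[ξ,η] + 2R(ξ,η)` (`sectionSnd_point`). The alternation
identity is the Jacobi identity, together with the fact that the isotropy algebra is closed under
the bracket. -/

theorem contDiffAt_fderiv_apply {f : E → F} {x : E} (hf : ContDiffAt ℝ ∞ f x) (v : E) :
    ContDiffAt ℝ ∞ (fun y => fderiv ℝ f y v) x :=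
  (hf.fderiv_right (m := ∞) (by simp)).clm_apply contDiffAt_const

theorem ContDiffAt.differentiableAt_of_smooth {f : E → F} {x : E} (hf : ContDiffAt ℝ ∞ f x) :
    DifferentiableAt ℝ f x :=
  hf.differentiableAt (by simp)

/-- Second derivatives of smooth functions commute. -/
theorem fderiv_fderiv_apply_comm {f : E → F} {x : E} (hf : ContDiffAt ℝ ∞ f x) (v w : E) :
    fderiv ℝ (fun y => fderiv ℝ f y v) x w = fderiv ℝ (fun y => fderiv ℝ f y w) x v := by
  have hd : DifferentiableAt ℝ (fderiv ℝ f) x :=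
    (hf.fderiv_right (m := ∞) (by simp)).differentiableAt_of_smooth
  have h (u t : E) : fderiv ℝ (fun y => fderiv ℝ f y u) x t = fderiv ℝ (fderiv ℝ f) x t u := by
    rw [fderiv_clm_apply hd (differentiableAt_const u)]
    simp
  rw [h, h]
  exact (hf.isSymmSndFDerivAt (by
    rw [minSmoothness_of_isRCLikeNormedField]; exact ENat.LEInfty.out)).eq w v

theorem fderiv_apply_const {T : E → F →L[ℝ] V} {x : E} (hT : DifferentiableAt ℝ T x) (v : F)
    (w : E) : fderiv ℝ (fun y => T y v) x w = fderiv ℝ T x w v := by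
  rw [fderiv_clm_apply hT (differentiableAt_const v)]
  simp

/-- The product rule with the first summand kept as the derivative of `T y v` for a frozen vector
`v`. This is the form in which derivatives of vector fields such as `y ↦ L_y v` enter later. -/
theorem fderiv_clm_apply_eq_add {T : E → F →L[ℝ] V} {u : E → F} {x : E}
    (hT : DifferentiableAt ℝ T x) (hu : DifferentiableAt ℝ u x) (w : E) :
    fderiv ℝ (fun y => T y (u y)) x w =
      fderiv ℝ (fun y => T y (u x)) x w + T x (fderiv ℝ u x w) := by
  rw [fderiv_clm_apply hT hu, fderiv_apply_const hT]
  simp [add_comm]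

theorem ContDiffAt.eventually_differentiableAt {f : E → F} {x : E} (hf : ContDiffAt ℝ ∞ f x) :
    ∀ᶠ y in 𝓝 x, DifferentiableAt ℝ f y :=
  ((hf.of_le ENat.LEInfty.out : ContDiffAt ℝ 1 f x).eventually
    (by simp)).mono fun _ h => h.differentiableAt (by simp)

theorem hasDerivAt_smul_const_zero (v : E) : HasDerivAt (fun t : ℝ => t • v) v 0 := by
  simpa using (hasDerivAt_id (0 : ℝ)).smul_const v

theorem ContDiffAt.hasDerivAt_comp_smul {f : E → F} (hf : ContDiffAt ℝ ∞ f 0) (v : E) :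
    HasDerivAt (fun t : ℝ => f (t • v)) (fderiv ℝ f 0 v) 0 := by
  have h : HasFDerivAt f (fderiv ℝ f 0) ((0 : ℝ) • v) := by
    rw [zero_smul]; exact hf.differentiableAt_of_smooth.hasFDerivAt
  exact h.comp_hasDerivAt (0 : ℝ) (hasDerivAt_smul_const_zero v)

theorem fderiv_comp_left {f : E × F → V} {p : E × F} (hf : DifferentiableAt ℝ f p) :
    fderiv ℝ (fun x => f (x, p.2)) p.1 = (fderiv ℝ f p).comp (ContinuousLinearMap.inl ℝ E F) :=
  (hf.hasFDerivAt.comp p.1 (hasFDerivAt_prodMk_left p.1 p.2)).fderiv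

theorem fderiv_comp_right {f : E × F → V} {p : E × F} (hf : DifferentiableAt ℝ f p) :
    fderiv ℝ (fun y => f (p.1, y)) p.2 = (fderiv ℝ f p).comp (ContinuousLinearMap.inr ℝ E F) :=
  (hf.hasFDerivAt.comp p.2 (hasFDerivAt_prodMk_right p.1 p.2)).fderiv

theorem eventually_isInvertible {X : Type*} [TopologicalSpace X] [CompleteSpace F]
    {T : X → F →L[ℝ] F} {x : X}
    (hT : ContinuousAt T x) (hx : T x = ContinuousLinearMap.id ℝ F) :
    ∀ᶠ y in 𝓝 x, (T y).IsInvertible := by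
  have h := (ContinuousLinearEquiv.refl ℝ F).nhds
  have e : ((ContinuousLinearEquiv.refl ℝ F : F ≃L[ℝ] F) : F →L[ℝ] F) = T x := by
    rw [hx]; rfl
  rw [e] at h
  exact hT h

/-- The smooth implicit function theorem near the origin, with smoothness on a neighbourhood. -/
theorem exists_smooth_implicit [CompleteSpace V] [CompleteSpace P] {Φ : V × P → V}
    (hΦ : ∀ᶠ z in 𝓝 (0 : V × P), ContDiffAt ℝ ∞ Φ z) (h0 : Φ 0 = 0)
    (hd : ∀ v, fderiv ℝ Φ 0 (v, 0) = v) :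
    ∃ φ : P → V, (∀ᶠ p in 𝓝 (0 : P), ContDiffAt ℝ ∞ φ p) ∧ φ 0 = 0 ∧
      ∀ᶠ z in 𝓝 (0 : V × P), Φ z = 0 ↔ z.1 = φ z.2 := by
  let A : P →L[ℝ] V := (fderiv ℝ Φ 0).comp (ContinuousLinearMap.inr ℝ V P)
  have hA (z : V × P) : fderiv ℝ Φ 0 z = z.1 + A z.2 := by
    have : z = (z.1, 0) + (0, z.2) := by simp
    conv_lhs => rw [this, map_add, hd]
    rfl
  -- Adjoining the parameter makes the differential invertible; the implicit function is the first
  -- component of the inverse of `F` on `0 × P`.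
  let F : V × P → V × P := fun z => (Φ z, z.2)
  let F' : (V × P) ≃L[ℝ] (V × P) := ContinuousLinearEquiv.equivOfInverse
    ((ContinuousLinearMap.fst ℝ V P + A.comp (ContinuousLinearMap.snd ℝ V P)).prod
      (ContinuousLinearMap.snd ℝ V P))
    ((ContinuousLinearMap.fst ℝ V P - A.comp (ContinuousLinearMap.snd ℝ V P)).prod
      (ContinuousLinearMap.snd ℝ V P))
    (fun z => by simp) (fun z => by simp)
  have hFs : ∀ᶠ z in 𝓝 (0 : V × P), ContDiffAt ℝ ∞ F z :=
    hΦ.mono fun z hz => hz.prodMk contDiffAt_snd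
  have hF0 : ContDiffAt ℝ ∞ F 0 := hFs.self_of_nhds
  have hF' : HasFDerivAt F (F' : V × P →L[ℝ] V × P) 0 := by
    have := (hΦ.self_of_nhds.differentiableAt_of_smooth.hasFDerivAt).prodMk
      (hasFDerivAt_snd (𝕜 := ℝ) (p := (0 : V × P)))
    have hEq : (F' : V × P →L[ℝ] V × P) =
        (fderiv ℝ Φ 0).prod (ContinuousLinearMap.snd ℝ V P) :=
      ContinuousLinearMap.ext fun z => Prod.ext (hA z).symm rfl
    rw [hEq]
    exact this
  let e := hF0.toOpenPartialHomeomorph F hF' (by simp)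
  have he : (e : V × P → V × P) = F := rfl
  have hF00 : F 0 = 0 := by simp [F, h0]
  have hsrc : (0 : V × P) ∈ e.source := hF0.mem_toOpenPartialHomeomorph_source hF' (by simp)
  have htgt : (0 : V × P) ∈ e.target := by
    have := hF0.image_mem_toOpenPartialHomeomorph_target hF' (by simp)
    rwa [hF00] at this
  have hsymm0 : e.symm 0 = 0 := by
    have := e.left_inv hsrc
    rwa [he, hF00] at this
  have hcont : ContinuousAt e.symm 0 := e.continuousAt_symm htgt
  -- Smoothness of the inverse on a whole neighbourhood needs the differential of `F` to be
  -- invertible at all nearby points.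
  have hinv : ∀ᶠ z in 𝓝 (0 : V × P), ∃ T : (V × P) ≃L[ℝ] (V × P),
      HasFDerivAt F (T : V × P →L[ℝ] V × P) z := by
    have hc : ContinuousAt (fderiv ℝ F) 0 := (hF0.fderiv_right (m := ∞) (by simp)).continuousAt
    have hn := F'.nhds
    rw [← hF'.fderiv] at hn
    filter_upwards [hc hn, hFs] with z hz hs
    obtain ⟨T, hT⟩ := hz
    exact ⟨T, by rw [hT]; exact hs.differentiableAt_of_smooth.hasFDerivAt⟩
  have hgood : ∀ᶠ z in 𝓝 (0 : V × P), ContDiffAt ℝ ∞ e.symm z := by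
    have h1 : ∀ᶠ z in 𝓝 (0 : V × P), ContDiffAt ℝ ∞ F (e.symm z) :=
      hcont.eventually (by rwa [hsymm0])
    have h2 := hcont.eventually (p := fun z => ∃ T : (V × P) ≃L[ℝ] (V × P),
      HasFDerivAt F (T : V × P →L[ℝ] V × P) z) (by rwa [hsymm0])
    filter_upwards [h1, h2, e.open_target.mem_nhds htgt] with z hz1 ⟨T, hT⟩ hz
    exact e.contDiffAt_symm hz hT hz1
  have hin : Filter.Tendsto (fun p : P => ((0 : V), p)) (𝓝 0) (𝓝 (0 : V × P)) :=
    (Continuous.prodMk_right (0 : V)).tendsto' _ _ rfl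
  refine ⟨fun p => (e.symm (0, p)).1, ?_, ?_, ?_⟩
  · filter_upwards [hin.eventually hgood] with p hp
    exact contDiffAt_fst.comp p (hp.comp p (contDiffAt_const.prodMk contDiffAt_id))
  · show (e.symm 0).1 = 0
    rw [hsymm0]; rfl
  · have hsnd : Filter.Tendsto (fun z : V × P => ((0 : V), z.2)) (𝓝 0) (𝓝 (0 : V × P)) :=
      (continuous_const.prodMk continuous_snd).tendsto' _ _ rfl
    filter_upwards [e.open_source.mem_nhds hsrc,
      hsnd.eventually (e.open_target.mem_nhds htgt)] with z hz hz'
    constructor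
    · intro h
      have h1 : e z = (0, z.2) := by rw [he]; simp [F, h]
      show z.1 = (e.symm (0, z.2)).1
      rw [← h1, e.left_inv hz]
    · intro h
      have h1 : F (e.symm (0, z.2)) = (0, z.2) := e.right_inv hz'
      have h2 : (e.symm (0, z.2)).2 = z.2 := by
        simpa [F] using congrArg Prod.snd h1
      have h3 : e.symm (0, z.2) = z := Prod.ext h.symm h2
      rw [h3] at h1
      exact congrArg Prod.fst h1

end Calculus

/-! ### The Chern connection and its curvature along the line `x = 0` -/

section WebCalculus

variable {W : Type*} [NormedAddCommGroup W] [NormedSpace ℝ W] {f : W × W → W} {p : W × W}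

theorem webP_eventuallyEq (hf : ContDiffAt ℝ ∞ f p) :
    webP f =ᶠ[𝓝 p] fun p' => (fderiv ℝ f p').comp (ContinuousLinearMap.inl ℝ W W) :=
  hf.eventually_differentiableAt.mono fun _ h => fderiv_comp_left h

theorem webQ_eventuallyEq (hf : ContDiffAt ℝ ∞ f p) :
    webQ f =ᶠ[𝓝 p] fun p' => (fderiv ℝ f p').comp (ContinuousLinearMap.inr ℝ W W) :=
  hf.eventually_differentiableAt.mono fun _ h => fderiv_comp_right h

theorem contDiffAt_webP (hf : ContDiffAt ℝ ∞ f p) : ContDiffAt ℝ ∞ (webP f) p :=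
  ((hf.fderiv_right (m := ∞) (by simp)).clm_comp contDiffAt_const).congr_of_eventuallyEq
    (webP_eventuallyEq hf)

theorem contDiffAt_webQ (hf : ContDiffAt ℝ ∞ f p) : ContDiffAt ℝ ∞ (webQ f) p :=
  ((hf.fderiv_right (m := ∞) (by simp)).clm_comp contDiffAt_const).congr_of_eventuallyEq
    (webQ_eventuallyEq hf)

theorem webMixed_eventuallyEq (hf : ContDiffAt ℝ ∞ f p) :
    webMixed f =ᶠ[𝓝 p] fun p' => (fderiv ℝ (webQ f) p').comp (ContinuousLinearMap.inl ℝ W W) :=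
  (contDiffAt_webQ hf).eventually_differentiableAt.mono fun _ h => fderiv_comp_left h

theorem contDiffAt_webMixed (hf : ContDiffAt ℝ ∞ f p) : ContDiffAt ℝ ∞ (webMixed f) p :=
  (((contDiffAt_webQ hf).fderiv_right (m := ∞) (by simp)).clm_comp
    contDiffAt_const).congr_of_eventuallyEq (webMixed_eventuallyEq hf)

/-- The order of differentiation in `webMixed` is immaterial. -/
theorem webMixed_apply (hf : ContDiffAt ℝ ∞ f p) (v z : W) :
    webMixed f p v z = fderiv ℝ (fun p' => webP f p' v) p (0, z) := by
  have hQ : (fun p' => webQ f p' z) =ᶠ[𝓝 p] fun p' => fderiv ℝ f p' (0, z) :=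
    (webQ_eventuallyEq hf).mono fun _ h => by simp [h]
  have hP : (fun p' => webP f p' v) =ᶠ[𝓝 p] fun p' => fderiv ℝ f p' (v, 0) :=
    (webP_eventuallyEq hf).mono fun _ h => by simp [h]
  rw [hP.fderiv_eq, fderiv_fderiv_apply_comm hf, ← hQ.fderiv_eq,
    fderiv_apply_const (contDiffAt_webQ hf).differentiableAt_of_smooth,
    (webMixed_eventuallyEq hf).eq_of_nhds]
  simp

/-- A vector with `ω₁ = 0` meets only one of the two `Γ` terms, and there `Q⁻¹` cancels `Q`. -/
theorem chernForm_right (hQ : (webQ f p).IsInvertible) (z v : W) :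
    chernForm f p (0, z) v = -webMixed f p ((webP f p).inverse v) z := by
  have : (webQ f p).inverse (webQ f p z) = z := hQ.inverse_apply_eq.2 rfl
  simp [chernForm, chernGamma, this]

theorem chernForm_left (hP : (webP f p).IsInvertible) (x v : W) :
    chernForm f p (x, 0) v = -webMixed f p x ((webQ f p).inverse v) := by
  have : (webP f p).inverse (webP f p x) = x := hP.inverse_apply_eq.2 rfl
  simp [chernForm, chernGamma, this]

variable [CompleteSpace W]

theorem contDiffAt_inverse_apply {E : Type*} [NormedAddCommGroup E] [NormedSpace ℝ E]
    {T : E → W →L[ℝ] W} {x : E} (hT : ContDiffAt ℝ ∞ T x) (h : (T x).IsInvertible) :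
    ContDiffAt ℝ ∞ (fun y => (T y).inverse) x :=
  (h.contDiffAt_map_inverse).comp x hT

theorem eventually_isInvertible_of_continuousAt {X : Type*} [TopologicalSpace X]
    {T : X → W →L[ℝ] W} {x : X} (hT : ContinuousAt T x) (h : (T x).IsInvertible) :
    ∀ᶠ y in 𝓝 x, (T y).IsInvertible := by
  obtain ⟨e, he⟩ := h
  have := e.nhds
  rw [he] at this
  exact hT this

/-- The smoothness of the connection form. -/
theorem contDiffAt_chernForm {E : Type*} [NormedAddCommGroup E] [NormedSpace ℝ E] {x : E}
    {c : E → W × W} (hf : ContDiffAt ℝ ∞ f (c x)) (hP : (webP f (c x)).IsInvertible)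
    (hQ : (webQ f (c x)).IsInvertible) (hc : ContDiffAt ℝ ∞ c x) {X : E → W × W}
    (hX : ContDiffAt ℝ ∞ X x) {v : E → W} (hv : ContDiffAt ℝ ∞ v x) :
    ContDiffAt ℝ ∞ (fun e => chernForm f (c e) (X e) (v e)) x := by
  have hcP := (contDiffAt_webP hf).comp x hc
  have hcQ := (contDiffAt_webQ hf).comp x hc
  have hiP := contDiffAt_inverse_apply hcP hP
  have hiQ := contDiffAt_inverse_apply hcQ hQ
  have hM := (contDiffAt_webMixed hf).comp x hc
  have hΓ {ξ η : E → W} (hξ : ContDiffAt ℝ ∞ ξ x) (hη : ContDiffAt ℝ ∞ η x) :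
      ContDiffAt ℝ ∞ (fun e => chernGamma f (c e) (ξ e) (η e)) x :=
    ((hM.clm_apply (hiP.clm_apply hξ)).clm_apply (hiQ.clm_apply hη)).neg
  exact (hΓ (hcP.clm_apply (contDiffAt_fst.comp x hX)) hv).add
    (hΓ hv (hcQ.clm_apply (contDiffAt_snd.comp x hX)))

/-- The smoothness of the curvature tensor. -/
theorem contDiffAt_webB (hf : ContDiffAt ℝ ∞ f p) (hP : (webP f p).IsInvertible)
    (hQ : (webQ f p).IsInvertible) (ξ η ζ : W) :
    ContDiffAt ℝ ∞ (fun p' => webB f p' ξ η ζ) p := by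
  have hX : ContDiffAt ℝ ∞ (fun p' => ((webP f p').inverse η, (0 : W))) p :=
    ((contDiffAt_inverse_apply (contDiffAt_webP hf) hP).clm_apply contDiffAt_const).prodMk
      contDiffAt_const
  have hY : ContDiffAt ℝ ∞ (fun p' => ((0 : W), (webQ f p').inverse ζ)) p :=
    contDiffAt_const.prodMk
      ((contDiffAt_inverse_apply (contDiffAt_webQ hf) hQ).clm_apply contDiffAt_const)
  -- The vector in the connection form depends on the base point but is frozen while the form is
  -- differentiated; two independent points `p'`, `p''` separate these roles.
  have hD {A B : W × W → W × W} (hA : ContDiffAt ℝ ∞ A p) (hB : ContDiffAt ℝ ∞ B p) :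
      ContDiffAt ℝ ∞ (fun p' => fderiv ℝ (fun p'' => chernForm f p'' (B p') ξ) p' (A p')) p := by
    have h : ContDiffAt ℝ ∞
        (Function.uncurry fun p' p'' => chernForm f p'' (B p') ξ) (p, p) :=
      contDiffAt_chernForm (x := (p, p)) (c := Prod.snd) hf hP hQ contDiffAt_snd
        (hB.comp (p, p) contDiffAt_fst) contDiffAt_const
    exact (ContDiffAt.fderiv (m := ∞) h contDiffAt_id (by simp)).clm_apply hA
  have hF {A : W × W → W × W} {v : W × W → W} (hA : ContDiffAt ℝ ∞ A p)
      (hv : ContDiffAt ℝ ∞ v p) : ContDiffAt ℝ ∞ (fun p' => chernForm f p' (A p') (v p')) p :=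
    contDiffAt_chernForm (c := fun p' => p') hf hP hQ contDiffAt_id hA hv
  exact (((hD hX hY).sub (hD hY hX)).add (hF hX (hF hY contDiffAt_const))).sub
    (hF hY (hF hX contDiffAt_const))

/-- The curvature tensor along `x = 0`, for a product with `f (0, y) = y`. -/
theorem webB_eq_fderiv {y : W} (hs : ∀ᶠ p in 𝓝 ((0 : W), y), ContDiffAt ℝ ∞ f p)
    (h0 : ∀ᶠ y' in 𝓝 y, f (0, y') = y') (hP : (webP f (0, y)).IsInvertible) (ξ η ζ : W)
    (Z : W → W) (hZ : ∀ᶠ y' in 𝓝 y, Z y' =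
      fderiv ℝ (fun z => webP f (0, z) η) y' (webP f (0, y') ξ)
        - fderiv ℝ (fun p' => webP f p' ξ) (0, y') (η, 0)) :
    webB f (0, y) (webP f (0, y) ξ) (webP f (0, y) η) ζ =
      fderiv ℝ Z y ζ
        - fderiv ℝ (fun z => webP f (0, z) ((webP f (0, y)).inverse (Z y))) y ζ := by
  have hf := hs.self_of_nhds
  have hQid : ∀ᶠ y' in 𝓝 y, webQ f (0, y') = ContinuousLinearMap.id ℝ W := by
    filter_upwards [h0.eventually_nhds] with y' hy'
    show fderiv ℝ (fun z => f (0, z)) y' = _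
    rw [Filter.EventuallyEq.fderiv_eq (f := fun z => z) hy', fderiv_fun_id]
  have hQ0 := hQid.self_of_nhds
  have hQ : (webQ f (0, y)).IsInvertible := by
    rw [hQ0]; exact ⟨ContinuousLinearEquiv.refl ℝ W, rfl⟩
  have hiP := contDiffAt_inverse_apply (contDiffAt_webP hf) hP
  have hinr : ContDiffAt ℝ ∞ (fun z : W => ((0 : W), z)) y := contDiffAt_const.prodMk contDiffAt_id
  have hcinr : Filter.Tendsto (fun z : W => ((0 : W), z)) (𝓝 y) (𝓝 (0, y)) := hinr.continuousAt
  have hX (v : W) : ContDiffAt ℝ ∞ (fun z => webP f (0, z) v) y :=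
    ((contDiffAt_webP hf).comp y hinr).clm_apply contDiffAt_const
  have hMX : ∀ᶠ y' in 𝓝 y, ∀ v z : W,
      webMixed f (0, y') v z = fderiv ℝ (fun z => webP f (0, z) v) y' z := by
    filter_upwards [hcinr.eventually hs] with y' hy' v z
    rw [webMixed_apply hy', fderiv_comp_right (f := fun p' => webP f p' v) (p := (0, y'))
      ((contDiffAt_webP hy').clm_apply contDiffAt_const).differentiableAt_of_smooth]
    rfl
  have hMX0 := hMX.self_of_nhds
  set P := webP f (0, y) with hPdef
  have hPξ (v : W) : P.inverse (P v) = v := by rw [hP.inverse_apply_eq]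
  have hQinv (v : W) : (webQ f (0, y)).inverse v = v := by
    rw [hQ0, ContinuousLinearMap.inverse_id]; rfl
  have hκ : ContDiffAt ℝ ∞ (fun p' => (webP f p').inverse (P ξ)) (0, y) :=
    hiP.clm_apply contDiffAt_const
  have hPev := eventually_isInvertible_of_continuousAt (contDiffAt_webP hf).continuousAt hP
  have hQev := eventually_isInvertible_of_continuousAt (contDiffAt_webQ hf).continuousAt hQ
  -- The derivative of `P⁻¹`, obtained by differentiating the constant `P(P⁻¹(Pξ))`, with the second
  -- `Pξ` frozen.
  have hκ' (h : W × W) : fderiv ℝ (fun p' => (webP f p').inverse (P ξ)) (0, y) h =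
      -P.inverse (fderiv ℝ (fun p' => webP f p' ξ) (0, y) h) := by
    have h1 := fderiv_clm_apply_eq_add (contDiffAt_webP hf).differentiableAt_of_smooth
      hκ.differentiableAt_of_smooth h
    have h2 : (fun p' => webP f p' ((webP f p').inverse (P ξ))) =ᶠ[𝓝 (0, y)] fun _ => P ξ :=
      hPev.mono fun p' hp' => (hp'.inverse_apply_eq.1 rfl).symm
    rw [h2.fderiv_eq, ← hPdef, hPξ, fderiv_const_apply, zero_apply] at h1
    rw [← map_neg, eq_comm, hP.inverse_apply_eq, neg_eq_iff_add_eq_zero]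
    exact h1.symm
  -- This derivative leaves the line `x = 0` and produces a third derivative of `f`. Symmetry turns
  -- it into a `y`-derivative along the line; the second term comes from the variation of `P⁻¹`.
  have t1 : fderiv ℝ (fun p' => chernForm f p' (0, ζ) (P ξ)) (0, y) (η, 0) =
      -fderiv ℝ (fun z => fderiv ℝ (fun p' => webP f p' ξ) (0, z) (η, 0)) y ζ
        + webMixed f (0, y) (P.inverse (fderiv ℝ (fun p' => webP f p' ξ) (0, y) (η, 0))) ζ := by
    have e1 : (fun p' => chernForm f p' (0, ζ) (P ξ)) =ᶠ[𝓝 (0, y)]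
        fun p' => -((webMixed f p').flip ζ) ((webP f p').inverse (P ξ)) :=
      hQev.mono fun p' hp' => chernForm_right hp' _ _
    have hfl : ContDiffAt ℝ ∞ (fun p' => (webMixed f p').flip ζ) (0, y) := by
      have := (ContinuousLinearMap.flipₗᵢ ℝ W W W).toContinuousLinearEquiv.contDiff.contDiffAt.comp
        (0, y) (contDiffAt_webMixed hf)
      exact (this : ContDiffAt ℝ ∞ (fun p' => (webMixed f p').flip) (0, y)).clm_apply
        contDiffAt_const
    have e2 : (fun p' => ((webMixed f p').flip ζ) ξ) =ᶠ[𝓝 (0, y)]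
        fun p' => fderiv ℝ (fun p'' => webP f p'' ξ) p' (0, ζ) :=
      hs.mono fun p' hp' => webMixed_apply hp' ξ ζ
    have hPξs := (contDiffAt_webP hf).clm_apply (contDiffAt_const (c := ξ))
    rw [e1.fderiv_eq, fderiv_fun_neg, neg_apply,
      fderiv_clm_apply_eq_add hfl.differentiableAt_of_smooth hκ.differentiableAt_of_smooth,
      hκ', ← hPdef, hPξ, e2.fderiv_eq, fderiv_fderiv_apply_comm hPξs,
      fderiv_comp_right (f := fun p' => fderiv ℝ (fun p'' => webP f p'' ξ) p' (η, 0))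
        (p := (0, y)) (contDiffAt_fderiv_apply hPξs _).differentiableAt_of_smooth]
    simp [add_comm]
  have t2 : fderiv ℝ (fun p' => chernForm f p' (η, 0) (P ξ)) (0, y) (0, ζ) =
      -fderiv ℝ (fun z => fderiv ℝ (fun z => webP f (0, z) η) z (P ξ)) y ζ := by
    have hd := (contDiffAt_chernForm (x := ((0 : W), y)) (c := fun p' => p') hf hP hQ
      contDiffAt_id (contDiffAt_const (c := (η, (0 : W))))
      (contDiffAt_const (c := P ξ))).differentiableAt_of_smooth
    have e1 : (fun z => chernForm f (0, z) (η, 0) (P ξ)) =ᶠ[𝓝 y]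
        fun z => -fderiv ℝ (fun z => webP f (0, z) η) z (P ξ) := by
      filter_upwards [hcinr.eventually hPev, hQid, hMX] with z h1 h2 h3
      rw [chernForm_left h1, h2, ContinuousLinearMap.inverse_id, h3]
      rfl
    have := fderiv_comp_right hd
    rw [e1.fderiv_eq] at this
    have h := DFunLike.congr_fun this ζ
    rw [fderiv_fun_neg, neg_apply] at h
    exact h.symm
  have hXξ := hX ξ
  have hDX : ContDiffAt ℝ ∞ (fderiv ℝ (fun z => webP f (0, z) η)) y :=
    (hX η).fderiv_right (by simp)
  have hY : ContDiffAt ℝ ∞ (fun z => fderiv ℝ (fun p' => webP f p' ξ) (0, z) (η, 0)) y :=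
    (contDiffAt_fderiv_apply ((contDiffAt_webP hf).clm_apply
      (contDiffAt_const (c := ξ))) (η, 0)).comp y hinr
  have hZ' : Z =ᶠ[𝓝 y] fun y' => fderiv ℝ (fun z => webP f (0, z) η) y' (webP f (0, y') ξ)
        - fderiv ℝ (fun p' => webP f p' ξ) (0, y') (η, 0) := hZ
  have hform (v : W) : chernForm f (0, y) (0, ζ) v = -webMixed f (0, y) (P.inverse v) ζ :=
    chernForm_right hQ _ _
  have hform' (v : W) : chernForm f (0, y) (η, 0) v = -webMixed f (0, y) η v := by
    rw [chernForm_left hP, hQinv]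
  -- Put `X_v(z) = P(0,z)v` and let `M` be the mixed derivative. The quadratic term `M(η, M(ξ, ζ))`
  -- restores the variation of `X_ξ` missing from `t2`, completing the derivative of `DX_η(X_ξ)`.
  -- The other one, `M(P⁻¹M(η, Pξ), ζ)`, joins the last term of `t1` to give `M(P⁻¹Z, ζ)`.
  rw [webB, chernCurv, hQinv, ← hPdef, hPξ, t1, t2, hform, hform', hform, hform', hPξ, ← hMX0,
    hZ'.fderiv_eq, hZ.self_of_nhds,
    fderiv_fun_sub (hDX.clm_apply hXξ).differentiableAt_of_smooth hY.differentiableAt_of_smooth,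
    sub_apply,
    fderiv_clm_apply_eq_add hDX.differentiableAt_of_smooth hXξ.differentiableAt_of_smooth,
    ← hMX0, ← hMX0, ← hMX0, ← hPdef]
  simp only [map_neg, map_sub, neg_apply, sub_apply]
  abel

end WebCalculus

/-! ### Local actions and their fundamental vector fields -/

section Action

variable {E W : Type*} [NormedAddCommGroup E] [NormedSpace ℝ E]
  [NormedAddCommGroup W] [NormedSpace ℝ W]

/-- The second order term `β` of the product `x · y = x + y + β(x, y) + …`. -/
noncomputable def LocalLieGroup.mulSnd (G : LocalLieGroup E) : E →L[ℝ] E →L[ℝ] E :=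
  fderiv ℝ (fun x => fderiv ℝ (fun y => G.mul x y) 0) 0

theorem LocalLieGroup.contDiffAt_fderiv_mul (G : LocalLieGroup E) :
    ContDiffAt ℝ ∞ (fun x => fderiv ℝ (fun y => G.mul x y) 0) 0 := by
  have h : ContDiffAt ℝ ∞ (Function.uncurry G.mul) ((0 : E), (0 : E)) := G.smooth_mul.self_of_nhds
  exact ContDiffAt.fderiv (m := ∞) (g := fun _ => (0 : E)) h contDiffAt_const (by simp)

theorem LocalLieGroup.fderiv_fderiv_mul (G : LocalLieGroup E) (X Y : E) :
    fderiv ℝ (fun x => fderiv ℝ (fun y => G.mul x y) 0 Y) 0 X = G.mulSnd X Y :=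
  fderiv_apply_const G.contDiffAt_fderiv_mul.differentiableAt_of_smooth Y X

/-- The Lie bracket as a continuous bilinear map. -/
noncomputable def LocalLieGroup.bracketL (G : LocalLieGroup E) : E →L[ℝ] E →L[ℝ] E :=
  G.mulSnd - G.mulSnd.flip

theorem LocalLieGroup.bracketL_apply (G : LocalLieGroup E) (X Y : E) :
    G.bracketL X Y = G.mulSnd X Y - G.mulSnd Y X := rfl

theorem LocalLieGroup.bracket_eq (G : LocalLieGroup E) (X Y : E) :
    G.bracket X Y = G.bracketL X Y := by
  rw [LocalLieGroup.bracket, G.fderiv_fderiv_mul, G.fderiv_fderiv_mul, G.bracketL_apply]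

theorem LocalLieGroup.bracketL_swap (G : LocalLieGroup E) (X Y : E) :
    G.bracketL X Y = -G.bracketL Y X := by
  rw [G.bracketL_apply, G.bracketL_apply, neg_sub]

/-- A smooth local action of `G` near the point `0` of `W`. -/
structure LocalLieGroup.IsLocalAction (G : LocalLieGroup E) (ρ : E × W → W) : Prop where
  smooth : ∀ᶠ p in 𝓝 (0 : E × W), ContDiffAt ℝ ∞ ρ p
  zero_act : ∀ᶠ y in 𝓝 (0 : W), ρ (0, y) = y
  act_act : ∀ᶠ z in 𝓝 (0 : E × E × W), ρ (z.1, ρ (z.2.1, z.2.2)) = ρ (G.mul z.1 z.2.1, z.2.2)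

/-- The infinitesimal action: if `ρ` is an action, `actField ρ y v` is the value at `y` of the
fundamental vector field of `v`. -/
noncomputable def actField {U : Type*} (ρ : E × U → W) (y : U) : E →L[ℝ] W :=
  fderiv ℝ (fun g => ρ (g, y)) 0

theorem contDiffAt_actField {U : Type*} [NormedAddCommGroup U] [NormedSpace ℝ U] {ρ : E × U → W}
    {y : U} (hρ : ContDiffAt ℝ ∞ ρ (0, y)) : ContDiffAt ℝ ∞ (actField ρ) y := by
  have h : ContDiffAt ℝ ∞ (Function.uncurry fun z g => ρ (g, z)) (y, (0 : E)) :=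
    hρ.comp (y, (0 : E)) (contDiffAt_snd.prodMk contDiffAt_fst)
  exact ContDiffAt.fderiv (m := ∞) (g := fun _ => (0 : E)) h contDiffAt_const (by simp)

/-- The second order term at `y` of the action, as a function of the group element. -/
noncomputable def actSnd (ρ : E × W → W) (y : W) (v v' : E) : W :=
  fderiv ℝ (fun g => fderiv ℝ (fun g' => ρ (g', y)) g v') 0 v

theorem tendsto_zero_prodMk {X Y : Type*} [TopologicalSpace X] [Zero X] [TopologicalSpace Y]
    [Zero Y] : Filter.Tendsto (fun y : Y => ((0 : X), y)) (𝓝 0) (𝓝 (0 : X × Y)) :=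
  (Continuous.prodMk_right (0 : X)).tendsto' _ _ rfl

namespace LocalLieGroup.IsLocalAction

variable {G : LocalLieGroup E} {ρ : E × W → W}

theorem eventually_smooth (hρ : G.IsLocalAction ρ) :
    ∀ᶠ y in 𝓝 (0 : W), ∀ᶠ p in 𝓝 ((0 : E), y), ContDiffAt ℝ ∞ ρ p :=
  tendsto_zero_prodMk.eventually hρ.smooth.eventually_nhds

theorem contDiffAt_actField (hρ : G.IsLocalAction ρ) :
    ∀ᶠ y in 𝓝 (0 : W), ContDiffAt ℝ ∞ (actField ρ) y :=
  hρ.eventually_smooth.mono fun _ hy => _root_.contDiffAt_actField hy.self_of_nhds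

theorem actSnd_comm (hρ : G.IsLocalAction ρ) :
    ∀ᶠ y in 𝓝 (0 : W), ∀ v v', actSnd ρ y v v' = actSnd ρ y v' v := by
  filter_upwards [hρ.eventually_smooth] with y hy v v'
  have h : ContDiffAt ℝ ∞ (fun g => ρ (g, y)) (0 : E) :=
    hy.self_of_nhds.comp (0 : E) (contDiffAt_id.prodMk contDiffAt_const)
  exact fderiv_fderiv_apply_comm h _ _

/-- The derivative of a fundamental vector field along another one. -/
theorem fderiv_actField (hρ : G.IsLocalAction ρ) : ∀ᶠ y in 𝓝 (0 : W), ∀ v v',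
    fderiv ℝ (fun z => actField ρ z v) y (actField ρ y v') =
      actSnd ρ y v v' + actField ρ y (G.mulSnd v v') := by
  have hact : ∀ᶠ y in 𝓝 (0 : W), ∀ᶠ g in 𝓝 (0 : E), ∀ᶠ h in 𝓝 (0 : E),
      ρ (g, ρ (h, y)) = ρ (G.mul g h, y) := by
    have ht : Filter.Tendsto (fun t : W × E × E => (t.2.1, t.2.2, t.1)) (𝓝 (0, 0, 0))
        (𝓝 (0 : E × E × W)) := by
      have : Continuous (fun t : W × E × E => (t.2.1, t.2.2, t.1)) := by fun_prop
      exact this.tendsto' _ _ rfl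
    filter_upwards [(ht.eventually hρ.act_act).curry_nhds] with y hy
    exact hy.curry_nhds
  have hmul : ∀ᶠ g in 𝓝 (0 : E), DifferentiableAt ℝ (fun h => G.mul g h) 0 := by
    have ht : Filter.Tendsto (fun g : E => (g, (0 : E))) (𝓝 0) (𝓝 (0 : E × E)) :=
      (Continuous.prodMk_left (0 : E)).tendsto' _ _ rfl
    filter_upwards [ht.eventually G.smooth_mul] with g hg
    exact (hg.comp (0 : E)
      ((contDiffAt_const (c := g)).prodMk contDiffAt_id)).differentiableAt_of_smooth
  have hmul0 : fderiv ℝ (fun h => G.mul 0 h) 0 = ContinuousLinearMap.id ℝ E := by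
    rw [Filter.EventuallyEq.fderiv_eq (f := fun h => h) G.one_mul, fderiv_fun_id]
  filter_upwards [hact, hρ.eventually_smooth, hρ.zero_act.eventually_nhds] with y hy hs h0 v v'
  have h0y : ρ (0, y) = y := h0.self_of_nhds
  have hs0 := hs.self_of_nhds
  have hgy : Filter.Tendsto (fun g : E => (g, y)) (𝓝 0) (𝓝 (0, y)) :=
    (Continuous.prodMk_left y).tendsto' _ _ rfl
  have hcomp : ContDiffAt ℝ ∞ (fun g => ρ (g, y)) (0 : E) :=
    hs0.comp (0 : E) (contDiffAt_id.prodMk contDiffAt_const)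
  -- The action law `ρ(g, ρ(h, y)) = ρ(gh, y)` differentiated in `h` at the unit, with `g` fixed.
  have e1 : (fun g => fderiv ℝ ρ (g, y) (0, actField ρ y v')) =ᶠ[𝓝 0]
      fun g => fderiv ℝ (fun g' => ρ (g', y)) g (fderiv ℝ (fun h => G.mul g h) 0 v') := by
    filter_upwards [hy, hgy.eventually hs, hmul, G.mul_one] with g hg hsg hmg hg1
    have hl : HasFDerivAt (fun h => ρ (g, ρ (h, y)))
        ((fderiv ℝ ρ (g, y)).comp ((ContinuousLinearMap.inr ℝ E W).comp (actField ρ y))) 0 := by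
      have hin : HasFDerivAt (fun h => (g, ρ (h, y)))
          ((ContinuousLinearMap.inr ℝ E W).comp (actField ρ y)) 0 :=
        (hasFDerivAt_prodMk_right g (ρ (0, y))).comp (0 : E)
          hcomp.differentiableAt_of_smooth.hasFDerivAt
      have hout : HasFDerivAt ρ (fderiv ℝ ρ (g, y)) (g, ρ (0, y)) := by
        rw [h0y]; exact hsg.differentiableAt_of_smooth.hasFDerivAt
      exact hout.comp (0 : E) hin
    have hr : HasFDerivAt (fun h => ρ (G.mul g h, y))
        ((fderiv ℝ (fun g' => ρ (g', y)) g).comp (fderiv ℝ (fun h => G.mul g h) 0)) 0 := by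
      have hout : HasFDerivAt (fun g' => ρ (g', y)) (fderiv ℝ (fun g' => ρ (g', y)) g)
          (G.mul g 0) := by
        rw [hg1]
        exact (hsg.comp g (contDiffAt_id.prodMk
          contDiffAt_const)).differentiableAt_of_smooth.hasFDerivAt
      exact hout.comp (0 : E) hmg.hasFDerivAt
    have := hl.unique (hr.congr_of_eventuallyEq hg)
    exact DFunLike.congr_fun this v'
  have e2 : fderiv ℝ (fun g => fderiv ℝ ρ (g, y) (0, actField ρ y v')) 0 v =
      fderiv ℝ (fun z => actField ρ z v) y (actField ρ y v') := by
    have h1 := DFunLike.congr_fun (fderiv_comp_left (p := ((0 : E), y))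
      (contDiffAt_fderiv_apply hs0 (0, actField ρ y v')).differentiableAt_of_smooth) v
    have h2 := DFunLike.congr_fun (fderiv_comp_right (p := ((0 : E), y))
      (contDiffAt_fderiv_apply hs0 (v, 0)).differentiableAt_of_smooth) (actField ρ y v')
    have e3 : (fun z => actField ρ z v) =ᶠ[𝓝 y] fun z => fderiv ℝ ρ (0, z) (v, 0) := by
      have ht : Filter.Tendsto (fun z : W => ((0 : E), z)) (𝓝 y) (𝓝 (0, y)) :=
        (Continuous.prodMk_right (0 : E)).tendsto' _ _ rfl
      filter_upwards [ht.eventually hs] with z hz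
      exact DFunLike.congr_fun (fderiv_comp_left (p := ((0 : E), z))
        hz.differentiableAt_of_smooth) v
    rw [e3.fderiv_eq]
    exact h1.trans ((fderiv_fderiv_apply_comm hs0 _ _).trans h2.symm)
  have hu : DifferentiableAt ℝ (fun g => fderiv ℝ (fun h => G.mul g h) 0 v') 0 :=
    (G.contDiffAt_fderiv_mul.clm_apply contDiffAt_const).differentiableAt_of_smooth
  -- Now differentiate in `g`: varying the base point of the outer derivative gives `actSnd`,
  -- varying the left translation of `v'` gives `mulSnd`.
  rw [← e2, e1.fderiv_eq, fderiv_clm_apply_eq_add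
    (hcomp.fderiv_right (m := ∞) (by simp)).differentiableAt_of_smooth hu, hmul0,
    G.fderiv_fderiv_mul]
  rfl

/-- Fundamental vector fields form a Lie algebra. -/
theorem fderiv_actField_sub (hρ : G.IsLocalAction ρ) : ∀ᶠ y in 𝓝 (0 : W), ∀ v v',
    fderiv ℝ (fun z => actField ρ z v) y (actField ρ y v')
      - fderiv ℝ (fun z => actField ρ z v') y (actField ρ y v) =
      actField ρ y (G.bracketL v v') := by
  filter_upwards [hρ.fderiv_actField, hρ.actSnd_comm] with y h1 h2 v v'
  rw [h1, h1, h2 v' v, G.bracketL_apply, map_sub]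
  abel

/-- The Jacobi identity for the bracket, modulo the isotropy algebra. -/
theorem actField_jacobi (hρ : G.IsLocalAction ρ) (u v w : E) :
    actField ρ 0 (G.bracketL (G.bracketL w v) u) =
      actField ρ 0 (G.bracketL w (G.bracketL v u))
        + actField ρ 0 (G.bracketL (G.bracketL w u) v) := by
  have hb : ∀ᶠ y in 𝓝 (0 : W), ∀ v v', VectorField.lieBracket ℝ (fun z => actField ρ z v)
      (fun z => actField ρ z v') y = actField ρ y (G.bracketL v' v) := by
    filter_upwards [hρ.fderiv_actField_sub] with y hy v v'
    rw [VectorField.lieBracket_eq]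
    exact hy v' v
  have hs (v : E) : ContDiffAt ℝ ∞ (fun z => actField ρ z v) 0 :=
    hρ.contDiffAt_actField.self_of_nhds.clm_apply contDiffAt_const
  have hb' (v v' : E) : VectorField.lieBracket ℝ (fun z => actField ρ z v)
      (fun z => actField ρ z v') =ᶠ[𝓝 0] fun z => actField ρ z (G.bracketL v' v) :=
    hb.mono fun y hy => hy v v'
  -- The Jacobi identity of vector fields on `W` is read off at the point `0`, which loses the
  -- isotropy part; only the image under `L_0` is needed later.
  have h := VectorField.leibniz_identity_lieBracket (𝕜 := ℝ) (n := ∞) (by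
    rw [minSmoothness_of_isRCLikeNormedField]; exact ENat.LEInfty.out) (hs u) (hs v) (hs w)
  rw [(Filter.EventuallyEq.refl _ _).lieBracket_vectorField_eq (hb' v w),
    (hb' u v).lieBracket_vectorField_eq (Filter.EventuallyEq.refl _ _),
    (Filter.EventuallyEq.refl _ _).lieBracket_vectorField_eq (hb' u w)] at h
  simpa only [hb.self_of_nhds] using h

/-- The Lie bracket of two vector fields vanishes at a common zero, so the isotropy algebra of the
origin is a subalgebra. -/
theorem actField_bracketL_eq_zero (hρ : G.IsLocalAction ρ) {v v' : E}
    (hv : actField ρ 0 v = 0) (hv' : actField ρ 0 v' = 0) : actField ρ 0 (G.bracketL v v') = 0 := by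
  rw [← hρ.fderiv_actField_sub.self_of_nhds, hv, hv', map_zero, map_zero, sub_zero]

end LocalLieGroup.IsLocalAction

end Action

/-! ### Torsion and curvature of the web of an action -/

section ActionWeb

variable {E W : Type*} [NormedAddCommGroup E] [NormedSpace ℝ E]
  [NormedAddCommGroup W] [NormedSpace ℝ W]

/-- The product on `W` obtained by letting the points `q x` of a section act. -/
def actLaw (ρ : E × W → W) (q : W → E) (p : W × W) : W := ρ (q p.1, p.2)

/-- The second order term of the section `q`, corrected by the product of `G`; its
isotropy part governs the curvature of the web of `actLaw`. -/
noncomputable def sectionSnd (G : LocalLieGroup E) (q : W → E) : W →L[ℝ] W →L[ℝ] E :=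
  fderiv ℝ (fderiv ℝ q) 0 - (G.mulSnd.bilinearComp (fderiv ℝ q 0) (fderiv ℝ q 0)).flip

theorem sectionSnd_apply (G : LocalLieGroup E) (q : W → E) (ξ η : W) :
    sectionSnd G q ξ η =
      fderiv ℝ (fderiv ℝ q) 0 ξ η - G.mulSnd (fderiv ℝ q 0 η) (fderiv ℝ q 0 ξ) := rfl

/-- The projection of the Lie algebra on `W` along the isotropy algebra of the point `y`. -/
noncomputable def actProj {U : Type*} (ρ : E × U → W) (ι : W →L[ℝ] E) (y : U) : E →L[ℝ] W :=
  ((actField ρ y).comp ι).inverse.comp (actField ρ y)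

variable {G : LocalLieGroup E} {ρ : E × W → W} {q : W → E}

theorem eventually_contDiffAt_actLaw (hρ : G.IsLocalAction ρ)
    (hq : ∀ᶠ x in 𝓝 (0 : W), ContDiffAt ℝ ∞ q x) (hq0 : q 0 = 0) :
    ∀ᶠ p in 𝓝 (0 : W × W), ContDiffAt ℝ ∞ (actLaw ρ q) p := by
  have hc : ContinuousAt (fun p : W × W => (q p.1, p.2)) 0 :=
    (hq.self_of_nhds.continuousAt.comp (x := (0 : W × W)) continuousAt_fst).prodMk continuousAt_snd
  have ht : Filter.Tendsto (fun p : W × W => (q p.1, p.2)) (𝓝 0) (𝓝 (0 : E × W)) := by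
    have h : Filter.Tendsto (fun p : W × W => (q p.1, p.2)) (𝓝 0) (𝓝 (q 0, 0)) := hc
    rwa [hq0] at h
  have hfst : Filter.Tendsto (Prod.fst : W × W → W) (𝓝 0) (𝓝 0) := continuousAt_fst
  filter_upwards [ht.eventually hρ.smooth, hfst.eventually hq] with p h1 h2
  exact h1.comp p ((h2.comp p contDiffAt_fst).prodMk contDiffAt_snd)

theorem eventually_actLaw_zero (hρ : G.IsLocalAction ρ) (hq0 : q 0 = 0) :
    ∀ᶠ y in 𝓝 (0 : W), actLaw ρ q (0, y) = y :=
  hρ.zero_act.mono fun y hy => by rw [actLaw, hq0, hy]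

theorem webP_actLaw (hρ : G.IsLocalAction ρ) (hq : ∀ᶠ x in 𝓝 (0 : W), ContDiffAt ℝ ∞ q x)
    (hq0 : q 0 = 0) :
    ∀ᶠ y in 𝓝 (0 : W), webP (actLaw ρ q) (0, y) = (actField ρ y).comp (fderiv ℝ q 0) := by
  filter_upwards [hρ.eventually_smooth] with y hy
  have h1 : HasFDerivAt (fun g => ρ (g, y)) (actField ρ y) (q 0) := by
    rw [hq0]
    exact (hy.self_of_nhds.comp (0 : E) (contDiffAt_id.prodMk
      contDiffAt_const)).differentiableAt_of_smooth.hasFDerivAt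
  exact (h1.comp (0 : W) hq.self_of_nhds.differentiableAt_of_smooth.hasFDerivAt).fderiv

/-- The second order chain rule for `x ↦ ρ(q x, y)`: one term from the curvature of the orbit map,
one from that of the section. -/
theorem fderiv_webP_actLaw (hρ : G.IsLocalAction ρ) (hq : ∀ᶠ x in 𝓝 (0 : W), ContDiffAt ℝ ∞ q x)
    (hq0 : q 0 = 0) : ∀ᶠ y in 𝓝 (0 : W), ∀ ξ η,
      fderiv ℝ (fun p => webP (actLaw ρ q) p ξ) (0, y) (η, 0) =
        actSnd ρ y (fderiv ℝ q 0 η) (fderiv ℝ q 0 ξ)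
          + actField ρ y (fderiv ℝ (fderiv ℝ q) 0 η ξ) := by
  filter_upwards [hρ.eventually_smooth, tendsto_zero_prodMk.eventually
    (eventually_contDiffAt_actLaw hρ hq hq0)] with y hy hf ξ η
  have hqs := hq.self_of_nhds
  have hgy : ContinuousAt (fun x : W => (q x, y)) 0 := hqs.continuousAt.prodMk continuousAt_const
  have hgy' : Filter.Tendsto (fun x : W => (q x, y)) (𝓝 0) (𝓝 (0, y)) := by
    have h : Filter.Tendsto (fun x : W => (q x, y)) (𝓝 0) (𝓝 (q 0, y)) := hgy
    rwa [hq0] at h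
  have hT : ContDiffAt ℝ ∞ (fderiv ℝ (fun g => ρ (g, y))) (0 : E) :=
    (hy.self_of_nhds.comp (0 : E) (contDiffAt_id.prodMk contDiffAt_const)).fderiv_right (by simp)
  have hTq : ContDiffAt ℝ ∞ (fun x => fderiv ℝ (fun g => ρ (g, y)) (q x)) (0 : W) :=
    (show ContDiffAt ℝ ∞ (fderiv ℝ (fun g => ρ (g, y))) (q 0) by rwa [hq0]).comp (0 : W) hqs
  have e1 : (fun x => webP (actLaw ρ q) (x, y) ξ) =ᶠ[𝓝 0]
      fun x => fderiv ℝ (fun g => ρ (g, y)) (q x) (fderiv ℝ q x ξ) := by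
    filter_upwards [hgy'.eventually hy, hq] with x hx hqx
    have h1 : HasFDerivAt (fun g => ρ (g, y)) (fderiv ℝ (fun g => ρ (g, y)) (q x)) (q x) :=
      (hx.comp (q x) (contDiffAt_id.prodMk
        contDiffAt_const)).differentiableAt_of_smooth.hasFDerivAt
    exact DFunLike.congr_fun
      (h1.comp x hqx.differentiableAt_of_smooth.hasFDerivAt).fderiv ξ
  have h2 := DFunLike.congr_fun (fderiv_comp_left (f := fun p => webP (actLaw ρ q) p ξ)
    (p := ((0 : W), y))
    ((contDiffAt_webP hf).clm_apply contDiffAt_const).differentiableAt_of_smooth) η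
  rw [e1.fderiv_eq, fderiv_clm_apply_eq_add hTq.differentiableAt_of_smooth
    (contDiffAt_fderiv_apply hqs ξ).differentiableAt_of_smooth, hq0,
    fderiv_apply_const (hqs.fderiv_right (m := ∞) (by simp)).differentiableAt_of_smooth] at h2
  refine h2.symm.trans (congrArg₂ (· + ·) ?_ rfl)
  have h3 : HasFDerivAt (fun g => fderiv ℝ (fun g' => ρ (g', y)) g (fderiv ℝ q 0 ξ))
      (fderiv ℝ (fun g => fderiv ℝ (fun g' => ρ (g', y)) g (fderiv ℝ q 0 ξ)) 0) (q 0) := by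
    rw [hq0]
    exact (hT.clm_apply contDiffAt_const).differentiableAt_of_smooth.hasFDerivAt
  exact DFunLike.congr_fun
    (h3.comp (0 : W) hqs.differentiableAt_of_smooth.hasFDerivAt).fderiv η

theorem actProj_zero (hι : ∀ ξ, actField ρ 0 (fderiv ℝ q 0 ξ) = ξ) :
    actProj ρ (fderiv ℝ q 0) 0 = actField ρ 0 := by
  have : (actField ρ 0).comp (fderiv ℝ q 0) = ContinuousLinearMap.id ℝ W :=
    ContinuousLinearMap.ext hι
  rw [actProj, this, ContinuousLinearMap.inverse_id, ContinuousLinearMap.id_comp]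

theorem webP_actLaw_zero (hρ : G.IsLocalAction ρ) (hq : ∀ᶠ x in 𝓝 (0 : W), ContDiffAt ℝ ∞ q x)
    (hq0 : q 0 = 0) (hι : ∀ ξ, actField ρ 0 (fderiv ℝ q 0 ξ) = ξ) :
    webP (actLaw ρ q) 0 = ContinuousLinearMap.id ℝ W :=
  (webP_actLaw hρ hq hq0).self_of_nhds.trans (ContinuousLinearMap.ext hι)

theorem webQ_actLaw_zero (hρ : G.IsLocalAction ρ) (hq0 : q 0 = 0) :
    webQ (actLaw ρ q) 0 = ContinuousLinearMap.id ℝ W := by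
  show fderiv ℝ (fun y => actLaw ρ q (0, y)) 0 = _
  rw [Filter.EventuallyEq.fderiv_eq (f := fun z => z) (eventually_actLaw_zero hρ hq0),
    fderiv_fun_id]

theorem webMixed_actLaw_zero (hρ : G.IsLocalAction ρ)
    (hq : ∀ᶠ x in 𝓝 (0 : W), ContDiffAt ℝ ∞ q x) (hq0 : q 0 = 0) (v τ : W) :
    webMixed (actLaw ρ q) 0 v τ = fderiv ℝ (actField ρ) 0 τ (fderiv ℝ q 0 v) := by
  have hf := (eventually_contDiffAt_actLaw hρ hq hq0).self_of_nhds
  have h := DFunLike.congr_fun (fderiv_comp_right (f := fun p' => webP (actLaw ρ q) p' v)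
    (p := (0 : W × W))
    ((contDiffAt_webP hf).clm_apply contDiffAt_const).differentiableAt_of_smooth) τ
  have e : (fun z => webP (actLaw ρ q) (0, z) v) =ᶠ[𝓝 0]
      fun z => actField ρ z (fderiv ℝ q 0 v) :=
    (webP_actLaw hρ hq hq0).mono fun z hz => DFunLike.congr_fun hz _
  rw [webMixed_apply hf, ← fderiv_apply_const
    hρ.contDiffAt_actField.self_of_nhds.differentiableAt_of_smooth, ← e.fderiv_eq]
  exact h.symm

/-- The torsion tensor of the web of `actLaw` at the origin. -/
theorem webA_actLaw_zero (hρ : G.IsLocalAction ρ) (hq : ∀ᶠ x in 𝓝 (0 : W), ContDiffAt ℝ ∞ q x)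
    (hq0 : q 0 = 0) (hι : ∀ ξ, actField ρ 0 (fderiv ℝ q 0 ξ) = ξ) (ξ η : W) :
    webA (actLaw ρ q) 0 ξ η =
      -((1 / 2 : ℝ) • actField ρ 0 (G.bracketL (fderiv ℝ q 0 ξ) (fderiv ℝ q 0 η))) := by
  have hL := hρ.contDiffAt_actField.self_of_nhds.differentiableAt_of_smooth
  rw [webA, chernGamma, chernGamma, webP_actLaw_zero hρ hq hq0 hι, webQ_actLaw_zero hρ hq0,
    ContinuousLinearMap.inverse_id, ← hρ.fderiv_actField_sub.self_of_nhds, hι, hι,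
    fderiv_apply_const hL, fderiv_apply_const hL, ← smul_neg]
  simp only [ContinuousLinearMap.id_apply, webMixed_actLaw_zero hρ hq hq0]
  congr 1
  abel

variable [CompleteSpace W]

theorem eventually_isInvertible_actField (hρ : G.IsLocalAction ρ)
    (hι : ∀ ξ, actField ρ 0 (fderiv ℝ q 0 ξ) = ξ) :
    ∀ᶠ y in 𝓝 (0 : W), ((actField ρ y).comp (fderiv ℝ q 0)).IsInvertible :=
  eventually_isInvertible (hρ.contDiffAt_actField.self_of_nhds.continuousAt.clm_comp
    continuousAt_const) (ContinuousLinearMap.ext hι)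

/-- The curvature tensor of the web of `actLaw`, along `x = 0`. -/
theorem webB_actLaw (hρ : G.IsLocalAction ρ) (hq : ∀ᶠ x in 𝓝 (0 : W), ContDiffAt ℝ ∞ q x)
    (hq0 : q 0 = 0) (hι : ∀ ξ, actField ρ 0 (fderiv ℝ q 0 ξ) = ξ) :
    ∀ᶠ y in 𝓝 (0 : W), ∀ ξ η ζ,
      webB (actLaw ρ q) (0, y) (actField ρ y (fderiv ℝ q 0 ξ)) (actField ρ y (fderiv ℝ q 0 η))
        (actField ρ y (fderiv ℝ q 0 ζ)) =
      -actField ρ y (G.bracketL (sectionSnd G q ξ η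
        - fderiv ℝ q 0 (actProj ρ (fderiv ℝ q 0) y (sectionSnd G q ξ η))) (fderiv ℝ q 0 ζ)) := by
  -- The field `Z` of `webB_eq_fderiv` is the fundamental field of `-w(ξ, η)`: both terms contain
  -- `actSnd ρ y (ιη) (ιξ)`, which cancels and leaves `β(ιη, ιξ) - q''(ξ, η)`.
  have hZ : ∀ᶠ y in 𝓝 (0 : W), ∀ ξ η, actField ρ y (-sectionSnd G q ξ η) =
      fderiv ℝ (fun z => webP (actLaw ρ q) (0, z) η) y (webP (actLaw ρ q) (0, y) ξ)
        - fderiv ℝ (fun p' => webP (actLaw ρ q) p' ξ) (0, y) (η, 0) := by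
    filter_upwards [(webP_actLaw hρ hq hq0).eventually_nhds, fderiv_webP_actLaw hρ hq hq0,
      hρ.fderiv_actField] with y h1 h2 h3 ξ η
    have e : (fun z => webP (actLaw ρ q) (0, z) η) =ᶠ[𝓝 y]
        fun z => actField ρ z (fderiv ℝ q 0 η) := h1.mono fun z hz => DFunLike.congr_fun hz _
    have hsym := (fderiv_fderiv_apply_comm hq.self_of_nhds ξ η)
    have hd := (hq.self_of_nhds.fderiv_right (m := ∞) (by simp)).differentiableAt_of_smooth
    rw [fderiv_apply_const hd, fderiv_apply_const hd] at hsym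
    rw [e.fderiv_eq, h2, h1.self_of_nhds, ContinuousLinearMap.comp_apply, h3, hsym,
      sectionSnd_apply, map_neg, map_sub]
    abel
  filter_upwards [(webP_actLaw hρ hq hq0).eventually_nhds, hZ.eventually_nhds,
    hρ.fderiv_actField_sub, eventually_isInvertible_actField hρ hι, hρ.contDiffAt_actField,
    tendsto_zero_prodMk.eventually (eventually_contDiffAt_actLaw hρ hq hq0).eventually_nhds,
    (eventually_actLaw_zero hρ hq0).eventually_nhds] with y hP hZy hLie hinv hL hs h0 ξ η ζ
  have hPy := hP.self_of_nhds
  have hPy' (v : W) : actField ρ y (fderiv ℝ q 0 v) = webP (actLaw ρ q) (0, y) v := by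
    rw [hPy]; rfl
  have hB := webB_eq_fderiv hs h0 (by rwa [hPy]) ξ η (actField ρ y (fderiv ℝ q 0 ζ))
    (fun z => actField ρ z (-sectionSnd G q ξ η)) (hZy.mono fun z hz => hz ξ η)
  rw [hPy' ξ, hPy' η, hB]
  set w := sectionSnd G q ξ η
  set c := actProj ρ (fderiv ℝ q 0) y w with hc
  have hcN : (webP (actLaw ρ q) (0, y)).inverse (actField ρ y (-w)) = -c := by
    rw [hPy, map_neg, map_neg, hc]; rfl
  have e : (fun z => webP (actLaw ρ q) (0, z) (-c)) =ᶠ[𝓝 y]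
      fun z => actField ρ z (fderiv ℝ q 0 (-c)) := hP.mono fun z hz => DFunLike.congr_fun hz _
  -- The vector `w - ιc` is isotropic at `y`, so in the commutator of its fundamental field with
  -- that of `ιζ` only one of the two derivatives survives.
  have hLc : actField ρ y (w - fderiv ℝ q 0 c) = 0 := by
    rw [map_sub, sub_eq_zero]
    exact hinv.inverse_apply_eq.1 rfl
  have hLd := hL.differentiableAt_of_smooth
  have h := hLie (w - fderiv ℝ q 0 c) (fderiv ℝ q 0 ζ)
  rw [hLc, map_zero, sub_zero] at h
  rw [hcN, e.fderiv_eq, ← h, fderiv_apply_const hLd, fderiv_apply_const hLd,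
    fderiv_apply_const hLd, map_neg, map_neg, map_neg, map_sub]
  abel

/-- The curvature tensor of the web of `actLaw` at the origin. -/
theorem webB_actLaw_zero (hρ : G.IsLocalAction ρ) (hq : ∀ᶠ x in 𝓝 (0 : W), ContDiffAt ℝ ∞ q x)
    (hq0 : q 0 = 0) (hι : ∀ ξ, actField ρ 0 (fderiv ℝ q 0 ξ) = ξ) (ξ η ζ : W) :
    webB (actLaw ρ q) 0 ξ η ζ =
      -actField ρ 0 (G.bracketL (sectionSnd G q ξ η
        - fderiv ℝ q 0 (actField ρ 0 (sectionSnd G q ξ η))) (fderiv ℝ q 0 ζ)) := by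
  have h := (webB_actLaw hρ hq hq0 hι).self_of_nhds ξ η ζ
  rwa [hι, hι, hι, actProj_zero hι] at h

end ActionWeb

/-! ### The covariant derivative of the curvature -/

section ActionWebDerivative

variable {E W : Type*} [NormedAddCommGroup E] [NormedSpace ℝ E]
  [NormedAddCommGroup W] [NormedSpace ℝ W] [CompleteSpace W]
  {G : LocalLieGroup E} {ρ : E × W → W} {q : W → E}

theorem contDiffAt_actProj (hρ : G.IsLocalAction ρ)
    (hι : ∀ ξ, actField ρ 0 (fderiv ℝ q 0 ξ) = ξ) :
    ContDiffAt ℝ ∞ (actProj ρ (fderiv ℝ q 0)) 0 :=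
  (contDiffAt_inverse_apply (hρ.contDiffAt_actField.self_of_nhds.clm_comp contDiffAt_const)
    (eventually_isInvertible_actField hρ hι).self_of_nhds).clm_comp
      hρ.contDiffAt_actField.self_of_nhds

/-- Differentiate the factorization `L_y = (L_y ι) Π_y` at `0`, where `L_0 ι = id` and `Π_0 = L_0`.
-/
theorem fderiv_actField_eq_add (hρ : G.IsLocalAction ρ)
    (hι : ∀ ξ, actField ρ 0 (fderiv ℝ q 0 ξ) = ξ) (τ : W) (v : E) :
    fderiv ℝ (actField ρ) 0 τ v =
      fderiv ℝ (actField ρ) 0 τ (fderiv ℝ q 0 (actField ρ 0 v))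
        + fderiv ℝ (actProj ρ (fderiv ℝ q 0)) 0 τ v := by
  have hL := hρ.contDiffAt_actField.self_of_nhds.differentiableAt_of_smooth
  have hPi := (contDiffAt_actProj hρ hι).differentiableAt_of_smooth
  have hP : DifferentiableAt ℝ (fun y => (actField ρ y).comp (fderiv ℝ q 0)) 0 :=
    hL.clm_comp (differentiableAt_const _)
  have e : (fun y => actField ρ y v) =ᶠ[𝓝 0]
      fun y => (actField ρ y).comp (fderiv ℝ q 0) (actProj ρ (fderiv ℝ q 0) y v) := by
    filter_upwards [eventually_isInvertible_actField hρ hι] with y hy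
    exact hy.inverse_apply_eq.1 rfl
  rw [← fderiv_apply_const hL, e.fderiv_eq,
    fderiv_clm_apply_eq_add hP (hPi.clm_apply (differentiableAt_const v)), actProj_zero hι,
    fderiv_apply_const hPi, ← fderiv_apply_const hL]
  exact congrArg₂ (· + ·) rfl (hι _)

/-- The derivative of the projection along the isotropy algebra. -/
theorem fderiv_actProj (hρ : G.IsLocalAction ρ)
    (hι : ∀ ξ, actField ρ 0 (fderiv ℝ q 0 ξ) = ξ) (τ : W) (v : E) :
    fderiv ℝ (actProj ρ (fderiv ℝ q 0)) 0 τ v =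
      actField ρ 0 (G.bracketL (v - fderiv ℝ q 0 (actField ρ 0 v)) (fderiv ℝ q 0 τ)) := by
  have hL := hρ.contDiffAt_actField.self_of_nhds.differentiableAt_of_smooth
  -- Since `v - ιΠv` is isotropic at `0`, its bracket with `ιτ` is the derivative of its fundamental
  -- field along `τ`, and the factorization of `L_y` identifies this with `dΠ(τ)v`.
  rw [← hρ.fderiv_actField_sub.self_of_nhds, map_sub (actField ρ 0), hι (actField ρ 0 v),
    sub_self, map_zero, sub_zero, hι τ, fderiv_apply_const hL, map_sub, eq_sub_iff_add_eq, add_comm,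
    ← fderiv_actField_eq_add hρ hι]

/-- The covariant derivative of the curvature tensor of the web of `actLaw` at the origin. -/
theorem webNablaTwoB_actLaw (hρ : G.IsLocalAction ρ)
    (hq : ∀ᶠ x in 𝓝 (0 : W), ContDiffAt ℝ ∞ q x)
    (hq0 : q 0 = 0) (hι : ∀ ξ, actField ρ 0 (fderiv ℝ q 0 ξ) = ξ) (ξ η ζ τ : W) :
    webNablaTwoB (actLaw ρ q) 0 ξ η ζ τ =
      actField ρ 0 (G.bracketL (fderiv ℝ q 0
          (fderiv ℝ (actProj ρ (fderiv ℝ q 0)) 0 τ (sectionSnd G q ξ η))) (fderiv ℝ q 0 ζ))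
        - fderiv ℝ (actProj ρ (fderiv ℝ q 0)) 0 τ (G.bracketL (sectionSnd G q ξ η
          - fderiv ℝ q 0 (actField ρ 0 (sectionSnd G q ξ η))) (fderiv ℝ q 0 ζ)) := by
  have hf := (eventually_contDiffAt_actLaw hρ hq hq0).self_of_nhds
  have hP0 := webP_actLaw_zero hρ hq hq0 hι
  have hQ0 := webQ_actLaw_zero (q := q) hρ hq0
  have hid : (ContinuousLinearMap.id ℝ W).IsInvertible := ⟨ContinuousLinearEquiv.refl ℝ W, rfl⟩
  set ι := fderiv ℝ q 0 with hιdef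
  set w := sectionSnd G q with hw
  have hm := webMixed_actLaw_zero hρ hq hq0
  rw [← hιdef] at hm
  have hform (v : W) : chernForm (actLaw ρ q) 0 (0, τ) v =
      -fderiv ℝ (actField ρ) 0 τ (ι v) := by
    rw [chernForm_right (by rw [hQ0]; exact hid), hP0, ContinuousLinearMap.inverse_id,
      ContinuousLinearMap.id_apply, hm]
  have hc := hasDerivAt_smul_const_zero τ
  have hc0 : (0 : ℝ) • τ = 0 := zero_smul ℝ τ
  have hLs := hρ.contDiffAt_actField.self_of_nhds
  have hPs : ContDiffAt ℝ ∞ (fun y => (actField ρ y).comp ι) 0 := hLs.clm_comp contDiffAt_const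
  have hPi0 := (eventually_isInvertible_actField hρ hι).self_of_nhds
  have hNs : ContDiffAt ℝ ∞ (fun y => ((actField ρ y).comp ι).inverse) 0 :=
    contDiffAt_inverse_apply hPs hPi0
  have hLd := hLs.hasDerivAt_comp_smul τ
  have hPid := (contDiffAt_actProj hρ hι).hasDerivAt_comp_smul τ
  have hNd := hNs.hasDerivAt_comp_smul τ
  have hN0 : ((actField ρ 0).comp ι).inverse = ContinuousLinearMap.id ℝ W := by
    rw [show (actField ρ 0).comp ι = ContinuousLinearMap.id ℝ W from ContinuousLinearMap.ext hι,
      ContinuousLinearMap.inverse_id]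
  -- The derivative of `(L_y ι)⁻¹` along `τ` is exactly the connection form `hform`. Hence the three
  -- corrections for the arguments of `b` cancel against the variation of those arguments in `hg`.
  have hN' (v : W) : fderiv ℝ (fun y => ((actField ρ y).comp ι).inverse) 0 τ v =
      -fderiv ℝ (actField ρ) 0 τ (ι v) := by
    have e : (fun y => (actField ρ y).comp ι (((actField ρ y).comp ι).inverse v)) =ᶠ[𝓝 0]
        fun _ => v := by
      filter_upwards [eventually_isInvertible_actField hρ hι] with y hy
      exact (hy.inverse_apply_eq.1 rfl).symm
    have h := fderiv_clm_apply_eq_add hPs.differentiableAt_of_smooth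
      (hNs.clm_apply (contDiffAt_const (c := v))).differentiableAt_of_smooth τ
    rw [e.fderiv_eq, fderiv_const_apply, zero_apply,
      fderiv_apply_const hNs.differentiableAt_of_smooth, hN0, ContinuousLinearMap.id_apply] at h
    have h' : (fderiv ℝ (fun y => actField ρ y (ι v)) 0 τ) +
        actField ρ 0 (ι (fderiv ℝ (fun y => ((actField ρ y).comp ι).inverse) 0 τ v)) = 0 := h.symm
    rw [hι, fderiv_apply_const hLs.differentiableAt_of_smooth] at h'
    exact (neg_eq_of_add_eq_zero_right h').symm
  have hct : Filter.Tendsto (fun t : ℝ => t • τ) (𝓝 0) (𝓝 0) := by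
    have h := hc.continuousAt.tendsto
    rwa [hc0] at h
  have hg : (fun t : ℝ => webB (actLaw ρ q) (0, t • τ) ξ η ζ) =ᶠ[𝓝 0] fun t =>
      -actField ρ (t • τ) (G.bracketL
        (w (((actField ρ (t • τ)).comp ι).inverse ξ) (((actField ρ (t • τ)).comp ι).inverse η)
          - ι (actProj ρ ι (t • τ) (w (((actField ρ (t • τ)).comp ι).inverse ξ)
            (((actField ρ (t • τ)).comp ι).inverse η))))
        (ι (((actField ρ (t • τ)).comp ι).inverse ζ))) := by
    filter_upwards [hct.eventually (webB_actLaw hρ hq hq0 hι),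
      hct.eventually (eventually_isInvertible_actField hρ hι)] with t h1 h2
    have h3 (v : W) : actField ρ (t • τ) (ι (((actField ρ (t • τ)).comp ι).inverse v)) = v :=
      (h2.inverse_apply_eq.1 rfl).symm
    rw [← h1, h3, h3, h3]
  have hBs : HasDerivAt (fun t : ℝ => webB (actLaw ρ q) (0, t • τ) ξ η ζ)
      (fderiv ℝ (fun p' => webB (actLaw ρ q) p' ξ η ζ) 0 (0, τ)) 0 := by
    have h : HasFDerivAt (fun p' => webB (actLaw ρ q) p' ξ η ζ)
        (fderiv ℝ (fun p' => webB (actLaw ρ q) p' ξ η ζ) 0) ((0 : W), (0 : ℝ) • τ) := by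
      rw [hc0]
      exact (contDiffAt_webB hf (by rw [hP0]; exact hid)
        (by rw [hQ0]; exact hid) ξ η ζ).differentiableAt_of_smooth.hasFDerivAt
    exact h.comp_hasDerivAt (0 : ℝ) ((hasDerivAt_const (0 : ℝ) (0 : W)).prodMk hc)
  have happ (v : W) := hNd.clm_apply (hasDerivAt_const (0 : ℝ) v)
  have hwd := (w.hasFDerivAt.comp_hasDerivAt (0 : ℝ) (happ ξ)).clm_apply (happ η)
  have hAd := hwd.sub (ι.hasFDerivAt.comp_hasDerivAt (0 : ℝ) (hPid.clm_apply hwd))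
  have hbd := (G.bracketL.hasFDerivAt.comp_hasDerivAt (0 : ℝ) hAd).clm_apply
    (ι.hasFDerivAt.comp_hasDerivAt (0 : ℝ) (happ ζ))
  have hgd := (hLd.clm_apply hbd).neg
  have hval := hBs.unique (hgd.congr_of_eventuallyEq hg)
  have hb := webB_actLaw_zero hρ hq hq0 hι
  rw [← hιdef, ← hw] at hb
  simp only [webNablaTwoB, hQ0, ContinuousLinearMap.inverse_id, ContinuousLinearMap.id_apply,
    hform, hb]
  rw [hval]
  simp only [Function.comp_apply, Pi.sub_apply, hc0, hN0, hN', actProj_zero hι, map_zero, add_zero,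
    map_neg, map_sub, map_add, neg_apply, sub_apply, add_apply, ContinuousLinearMap.id_apply]
  -- The correction for the value of `b` removes from the derivative of the outer `L_y` its part
  -- along `ι`, leaving the derivative of `Π_y`.
  have h := fderiv_actField_eq_add hρ hι τ (G.bracketL (w ξ η - ι (actField ρ 0 (w ξ η))) (ι ζ))
  rw [← hιdef] at h
  simp only [map_sub, sub_apply] at h
  linear_combination (norm := skip) (-1 : ℝ) • h
  module

end ActionWebDerivative

/-! ### Local group calculus and the second order term of the exponential map -/

namespace LocalLieGroup

variable {E : Type*} [NormedAddCommGroup E] [NormedSpace ℝ E] (G : LocalLieGroup E)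

section Germs

variable {α : Type*} {l : Filter α} {a b c : α → E}

theorem mul_zero_zero : G.mul 0 0 = 0 := G.one_mul.self_of_nhds

theorem tendsto_mul (ha : Tendsto a l (𝓝 0)) (hb : Tendsto b l (𝓝 0)) :
    Tendsto (fun x => G.mul (a x) (b x)) l (𝓝 0) := by
  have hm : Tendsto (fun p : E × E => G.mul p.1 p.2) (𝓝 0) (𝓝 (G.mul 0 0)) :=
    G.smooth_mul.self_of_nhds.continuousAt
  rw [G.mul_zero_zero] at hm
  exact hm.comp (ha.prodMk_nhds hb)

theorem tendsto_inv (ha : Tendsto a l (𝓝 0)) : Tendsto (fun x => G.inv (a x)) l (𝓝 0) := by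
  have hm : Tendsto G.inv (𝓝 0) (𝓝 (G.inv 0)) := G.smooth_inv.self_of_nhds.continuousAt
  rw [G.inv_zero] at hm
  exact hm.comp ha

theorem eventually_assoc (ha : Tendsto a l (𝓝 0)) (hb : Tendsto b l (𝓝 0))
    (hc : Tendsto c l (𝓝 0)) :
    ∀ᶠ x in l, G.mul (G.mul (a x) (b x)) (c x) = G.mul (a x) (G.mul (b x) (c x)) :=
  (ha.prodMk_nhds (hb.prodMk_nhds hc)).eventually G.mul_assoc

theorem eventually_mul_inv_cancel (ha : Tendsto a l (𝓝 0)) (hb : Tendsto b l (𝓝 0)) :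
    ∀ᶠ x in l, G.mul (a x) (G.mul (G.inv (a x)) (b x)) = b x := by
  filter_upwards [G.eventually_assoc ha (G.tendsto_inv ha) hb, ha.eventually G.mul_inv,
    hb.eventually G.one_mul] with x h1 h2 h3
  rw [← h1, h2, h3]

end Germs

theorem contDiffAt_mul : ContDiffAt ℝ ∞ (fun p : E × E => G.mul p.1 p.2) 0 :=
  G.smooth_mul.self_of_nhds

theorem fderiv_mul (x y : E) : fderiv ℝ (fun p : E × E => G.mul p.1 p.2) 0 (x, y) = x + y := by
  have hd := G.contDiffAt_mul.differentiableAt_of_smooth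
  have h1 := DFunLike.congr_fun (fderiv_comp_left hd) x
  have h2 := DFunLike.congr_fun (fderiv_comp_right hd) y
  have e1 : (fun z => G.mul z 0) =ᶠ[𝓝 0] fun z => z := G.mul_one
  have e2 : (fun z => G.mul 0 z) =ᶠ[𝓝 0] fun z => z := G.one_mul
  have h1' : fderiv ℝ (fun z => G.mul z 0) 0 x =
    fderiv ℝ (fun p : E × E => G.mul p.1 p.2) 0 (x, 0) := h1
  have h2' : fderiv ℝ (fun z => G.mul 0 z) 0 y =
    fderiv ℝ (fun p : E × E => G.mul p.1 p.2) 0 (0, y) := h2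
  rw [e1.fderiv_eq, fderiv_fun_id] at h1'
  rw [e2.fderiv_eq, fderiv_fun_id] at h2'
  have : ((x, y) : E × E) = (x, 0) + (0, y) := by simp
  rw [this, map_add, ← h1', ← h2']
  rfl

theorem contDiffAt_inv : ContDiffAt ℝ ∞ G.inv 0 := G.smooth_inv.self_of_nhds

theorem hasFDerivAt_inv : HasFDerivAt G.inv (-ContinuousLinearMap.id ℝ E) 0 := by
  have hd := G.contDiffAt_inv.differentiableAt_of_smooth.hasFDerivAt
  have hm : HasFDerivAt (fun p : E × E => G.mul p.1 p.2)
      (fderiv ℝ (fun p : E × E => G.mul p.1 p.2) 0) ((0 : E), G.inv 0) := by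
    rw [G.inv_zero]
    exact G.contDiffAt_mul.differentiableAt_of_smooth.hasFDerivAt
  have hp : HasFDerivAt (fun x => (x, G.inv x))
      ((ContinuousLinearMap.id ℝ E).prod (fderiv ℝ G.inv 0)) 0 := (hasFDerivAt_id (0 : E)).prodMk hd
  have hl : HasFDerivAt (fun x => G.mul x (G.inv x))
      ((fderiv ℝ (fun p : E × E => G.mul p.1 p.2) 0).comp
        ((ContinuousLinearMap.id ℝ E).prod (fderiv ℝ G.inv 0))) 0 :=
    HasFDerivAt.comp (g := fun p : E × E => G.mul p.1 p.2) (f := fun x => (x, G.inv x)) 0 hm hp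
  have h := hl.unique ((hasFDerivAt_const (0 : E) (0 : E)).congr_of_eventuallyEq G.mul_inv)
  have e : fderiv ℝ G.inv 0 = -ContinuousLinearMap.id ℝ E := by
    ext v
    have hv := DFunLike.congr_fun h v
    have hv' : fderiv ℝ (fun p : E × E => G.mul p.1 p.2) 0 (v, fderiv ℝ G.inv 0 v) = 0 := hv
    rw [G.fderiv_mul] at hv'
    exact (neg_eq_of_add_eq_zero_right hv').symm
  rwa [e] at hd

variable {G} {e : E → E}

/-- Differentiate `e((s+t)x) = e(sx)·e(tx)` in `t` at `0`, then in `s` at `0`. The one-parameter law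
is available only for small `x`, but both sides are quadratic in `x`, so rescaling gives all `x`. -/
theorem IsExp.fderiv_fderiv_self (he : G.IsExp e) (x : E) :
    fderiv ℝ (fderiv ℝ e) 0 x x = G.mulSnd x x := by
  obtain ⟨hs, h0, h1, hhom⟩ := he
  have hs0 := hs.self_of_nhds
  have hev : ∀ᶠ x in 𝓝 (0 : E), fderiv ℝ (fderiv ℝ e) 0 x x = G.mulSnd x x := by
    have hsm : ∀ᶠ s : ℝ in 𝓝 0, s ∈ Set.Icc (-1 : ℝ) 1 :=
      Icc_mem_nhds (by norm_num) (by norm_num)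
    filter_upwards [hhom] with x hx
    have hc : Tendsto (fun s : ℝ => s • x) (𝓝 0) (𝓝 0) := by
      have h := (hasDerivAt_smul_const_zero x).continuousAt.tendsto
      rwa [zero_smul] at h
    have he0 : Tendsto e (𝓝 0) (𝓝 0) := by
      have h := hs0.continuousAt.tendsto
      rwa [h0] at h
    have hmul : ∀ᶠ g in 𝓝 (0 : E), DifferentiableAt ℝ (fun h => G.mul g h) 0 := by
      have ht : Tendsto (fun g : E => (g, (0 : E))) (𝓝 0) (𝓝 (0 : E × E)) :=
        (Continuous.prodMk_left (0 : E)).tendsto' _ _ rfl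
      filter_upwards [ht.eventually G.smooth_mul] with g hg
      exact (hg.comp (0 : E)
        ((contDiffAt_const (c := g)).prodMk contDiffAt_id)).differentiableAt_of_smooth
    have key : (fun s : ℝ => fderiv ℝ e (s • x) x) =ᶠ[𝓝 0]
        fun s => fderiv ℝ (fun h => G.mul (e (s • x)) h) 0 x := by
      filter_upwards [hsm, hc.eventually hs, (he0.comp hc).eventually hmul] with s hs' hes hms
      have hl : HasDerivAt (fun t : ℝ => e ((s + t) • x)) (fderiv ℝ e (s • x) x) 0 := by
        have ha : HasDerivAt (fun t : ℝ => (s + t) • x) x 0 := by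
          simpa using ((hasDerivAt_id (0 : ℝ)).const_add s).smul_const x
        have hb : HasFDerivAt e (fderiv ℝ e (s • x)) ((s + 0) • x) := by
          rw [add_zero]; exact hes.differentiableAt_of_smooth.hasFDerivAt
        exact hb.comp_hasDerivAt (0 : ℝ) ha
      have hr : HasDerivAt (fun t : ℝ => G.mul (e (s • x)) (e (t • x)))
          (fderiv ℝ (fun h => G.mul (e (s • x)) h) 0 x) 0 := by
        have ha := hs0.hasDerivAt_comp_smul x
        rw [h1.fderiv] at ha
        have hb : HasFDerivAt (fun h => G.mul (e (s • x)) h)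
            (fderiv ℝ (fun h => G.mul (e (s • x)) h) 0) (e ((0 : ℝ) • x)) := by
          rw [zero_smul, h0]; exact hms.hasFDerivAt
        exact hb.comp_hasDerivAt (0 : ℝ) ha
      exact hl.unique (hr.congr_of_eventuallyEq (hsm.mono fun t ht => hx s hs' t ht))
    have hl := (contDiffAt_fderiv_apply hs0 x).hasDerivAt_comp_smul x
    rw [fderiv_apply_const (hs0.fderiv_right (m := ∞) (by simp)).differentiableAt_of_smooth] at hl
    have hr : HasDerivAt (fun s : ℝ => fderiv ℝ (fun h => G.mul (e (s • x)) h) 0 x)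
        (G.mulSnd x x) 0 := by
      have ha := hs0.hasDerivAt_comp_smul x
      rw [h1.fderiv] at ha
      have hb : HasFDerivAt (fun g => fderiv ℝ (fun h => G.mul g h) 0 x)
          (fderiv ℝ (fun g => fderiv ℝ (fun h => G.mul g h) 0 x) 0) (e ((0 : ℝ) • x)) := by
        rw [zero_smul, h0]
        exact (G.contDiffAt_fderiv_mul.clm_apply
          contDiffAt_const).differentiableAt_of_smooth.hasFDerivAt
      have := hb.comp_hasDerivAt (0 : ℝ) ha
      rwa [G.fderiv_fderiv_mul] at this
    exact hl.unique (hr.congr_of_eventuallyEq key)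
  have hc : Tendsto (fun s : ℝ => s • x) (𝓝[≠] 0) (𝓝 0) := by
    have h := (hasDerivAt_smul_const_zero x).continuousAt.tendsto
    rw [zero_smul] at h
    exact h.mono_left nhdsWithin_le_nhds
  obtain ⟨s, hs1, hs2⟩ := ((hc.eventually hev).and self_mem_nhdsWithin).exists
  simp only [map_smul, smul_apply] at hs1
  exact smul_right_injective E hs2 (smul_right_injective E hs2 hs1)

/-- The second derivative of the exponential map. -/
theorem IsExp.fderiv_fderiv (he : G.IsExp e) (x y : E) :
    fderiv ℝ (fderiv ℝ e) 0 x y = (1 / 2 : ℝ) • (G.mulSnd x y + G.mulSnd y x) := by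
  have hs0 := he.1.self_of_nhds
  have hd := (hs0.fderiv_right (m := ∞) (by simp)).differentiableAt_of_smooth
  have hsym := fderiv_fderiv_apply_comm hs0 x y
  rw [fderiv_apply_const hd, fderiv_apply_const hd] at hsym
  -- Polarization, using the symmetry of the second derivative.
  have hxy := he.fderiv_fderiv_self (x + y)
  simp only [map_add, add_apply, he.fderiv_fderiv_self x, he.fderiv_fderiv_self y, hsym] at hxy
  have h2 : (2 : ℝ) • fderiv ℝ (fderiv ℝ e) 0 x y = G.mulSnd x y + G.mulSnd y x := by
    linear_combination (norm := skip) (1 : ℝ) • hxy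
    module
  rw [← h2, smul_smul]
  norm_num

end LocalLieGroup

/-! ### The section `Q` in exponential coordinates -/

section SectionMap

variable {E : Type*} [NormedAddCommGroup E] [NormedSpace ℝ E] [FiniteDimensional ℝ E]

/-- The projection on `V` along `h` as a continuous linear map. -/
noncomputable def complProj (V h : Submodule ℝ E) (hc : IsCompl V h) : E →L[ℝ] V :=
  LinearMap.toContinuousLinearMap (V.projectionOnto h hc)

theorem complProj_coe {V h : Submodule ℝ E} (hc : IsCompl V h) (v : V) :
    complProj V h hc v = v := Submodule.projectionOnto_apply_left hc v

theorem complProj_eq_zero_iff {V h : Submodule ℝ E} (hc : IsCompl V h) {x : E} :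
    complProj V h hc x = 0 ↔ x ∈ h := Submodule.projectionOnto_apply_eq_zero_iff hc

/-- A function with the defining property of the section map is smooth near `0`, and all such
functions have the same germ. -/
theorem exists_smooth_sectionMap {exp : E → E} (he : ∀ᶠ x in 𝓝 (0 : E), ContDiffAt ℝ ∞ exp x)
    (he0 : exp 0 = 0) (hed : HasFDerivAt exp (ContinuousLinearMap.id ℝ E) 0) {Q : Set E}
    {V h : Submodule ℝ E} (hc : IsCompl V h) (hQ : IsSubmanifoldAtZero Q V) :
    ∃ φ : V → h, IsSectionMap exp Q V h φ ∧ (∀ᶠ x in 𝓝 (0 : V), ContDiffAt ℝ ∞ φ x) ∧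
      fderiv ℝ φ 0 = 0 ∧ ∀ ψ, IsSectionMap exp Q V h ψ → ψ =ᶠ[𝓝 0] φ := by
  obtain ⟨Ψ, hΨs, hΨ0, hΨd, hΨ⟩ := hQ
  let j : h × V →L[ℝ] E := h.subtypeL.comp (ContinuousLinearMap.fst ℝ h V) +
    V.subtypeL.comp (ContinuousLinearMap.snd ℝ h V)
  have hj (η : h) (ξ : V) : j (η, ξ) = (ξ : E) + (η : E) := by simp [j, add_comm]
  have hj0 : Tendsto j (𝓝 0) (𝓝 0) := j.continuous.tendsto' _ _ (map_zero j)
  have het : Tendsto exp (𝓝 0) (𝓝 0) := by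
    have := he.self_of_nhds.continuousAt.tendsto
    rwa [he0] at this
  let pr := complProj h V hc.symm
  -- The `h`-component of the slice chart: near `0` its zeros are the pairs `(η, ξ)` with `exp(ξ +
  -- η) ∈ Q`, and its derivative in `η` at `0` is the identity.
  let Φ : h × V → h := fun z => pr (Ψ (exp (j z)))
  have hΦs : ∀ᶠ z in 𝓝 (0 : h × V), ContDiffAt ℝ ∞ Φ z := by
    filter_upwards [hj0.eventually he, (het.comp hj0).eventually hΨs] with z h1 h2
    exact pr.contDiff.contDiffAt.comp z (h2.comp z (h1.comp z j.contDiff.contDiffAt))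
  have hΦ0 : Φ 0 = 0 := by simp only [Φ, map_zero, he0, hΨ0]
  have hΦd : HasFDerivAt Φ (pr.comp j) 0 := by
    have h1 : HasFDerivAt exp (ContinuousLinearMap.id ℝ E) (j 0) := by rwa [map_zero]
    have h2 : HasFDerivAt Ψ (ContinuousLinearMap.id ℝ E) (exp (j 0)) := by rwa [map_zero, he0]
    have h3 : HasFDerivAt (fun z => exp (j z)) j 0 :=
      HasFDerivAt.comp (g := exp) (f := j) 0 h1 j.hasFDerivAt
    have h4 : HasFDerivAt (fun z => Ψ (exp (j z))) j 0 :=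
      HasFDerivAt.comp (g := Ψ) (f := fun z => exp (j z)) 0 h2 h3
    exact pr.hasFDerivAt.comp (0 : h × V) h4
  have hpj (η : h) (ξ : V) : pr (j (η, ξ)) = η := by
    rw [hj, map_add, (complProj_eq_zero_iff hc.symm).2 ξ.2, zero_add]
    exact complProj_coe hc.symm η
  have hmem : ∀ᶠ z in 𝓝 (0 : h × V), exp ((z.2 : E) + (z.1 : E)) ∈ Q ↔ Φ z = 0 := by
    filter_upwards [(het.comp hj0).eventually hΨ] with z hz
    rw [← hj]
    exact hz.trans (complProj_eq_zero_iff hc.symm).symm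
  obtain ⟨φ, hφs, hφ0, hφ⟩ := exists_smooth_implicit hΦs hΦ0 (fun v => by
    rw [hΦd.fderiv]; exact hpj v 0)
  have hgraph {ψ : V → h} (h0 : ψ 0 = 0) (hψ : ContinuousAt ψ 0) :
      Tendsto (fun ξ => (ψ ξ, ξ)) (𝓝 0) (𝓝 (0 : h × V)) := by
    have h1 := hψ.tendsto
    rw [h0] at h1
    exact h1.prodMk_nhds tendsto_id
  have hφg := hgraph hφ0 hφs.self_of_nhds.continuousAt
  have hφΦ : ∀ᶠ ξ in 𝓝 (0 : V), Φ (φ ξ, ξ) = 0 :=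
    (hφg.eventually hφ).mono fun ξ hξ => hξ.2 rfl
  refine ⟨φ, ⟨hφ0, hφs.self_of_nhds.continuousAt, ?_⟩, hφs, ?_, ?_⟩
  · filter_upwards [hφΦ, hφg.eventually hmem] with ξ h1 h2
    exact h2.2 h1
  · have h1 : HasFDerivAt Φ (pr.comp j) (φ 0, 0) := by rwa [hφ0]
    have hp : HasFDerivAt (fun ξ => (φ ξ, ξ))
        ((fderiv ℝ φ 0).prod (ContinuousLinearMap.id ℝ V)) 0 :=
      hφs.self_of_nhds.differentiableAt_of_smooth.hasFDerivAt.prodMk (hasFDerivAt_id (0 : V))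
    have h2 : HasFDerivAt (fun ξ => Φ (φ ξ, ξ))
        ((pr.comp j).comp ((fderiv ℝ φ 0).prod (ContinuousLinearMap.id ℝ V))) 0 :=
      HasFDerivAt.comp (g := Φ) (f := fun ξ => (φ ξ, ξ)) 0 h1 hp
    have h3 := h2.unique ((hasFDerivAt_const (0 : h) (0 : V)).congr_of_eventuallyEq hφΦ)
    ext1 ξ
    exact (hpj _ ξ).symm.trans (DFunLike.congr_fun h3 ξ)
  · rintro ψ ⟨h0, hψ, hψQ⟩
    have hψg := hgraph h0 hψ
    filter_upwards [hψQ, hψg.eventually hmem, hψg.eventually hφ] with ξ h1 h2 h3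
    exact h3.1 (h2.1 h1)

namespace LoopInGroup

variable (S : LoopInGroup E)

/-- `sectionMap` is an arbitrary choice, but all candidates have the same germ, so the chosen one
inherits smoothness and the vanishing differential. -/
theorem sectionMap_spec :
    IsSectionMap S.exp S.Q S.V S.h (sectionMap S.exp S.Q S.V S.h) ∧
      (∀ᶠ x in 𝓝 (0 : S.V), ContDiffAt ℝ ∞ (sectionMap S.exp S.Q S.V S.h) x) ∧
      fderiv ℝ (sectionMap S.exp S.Q S.V S.h) 0 = 0 := by
  obtain ⟨he, he0, hed, -⟩ := S.isExp
  obtain ⟨φ, h1, h2, h3, h4⟩ := exists_smooth_sectionMap he he0 hed S.isCompl S.isSubmanifold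
  have hs : IsSectionMap S.exp S.Q S.V S.h (sectionMap S.exp S.Q S.V S.h) :=
    Classical.epsilon_spec ⟨φ, h1⟩
  have he := h4 _ hs
  refine ⟨hs, ?_, by rw [he.fderiv_eq, h3]⟩
  filter_upwards [h2, he.eventuallyEq_nhds] with x hx hx'
  exact hx.congr_of_eventuallyEq hx'

theorem point_zero : S.point 0 = 0 := by
  rw [point, sectionPoint, S.sectionMap_spec.1.1]
  simpa using S.isExp.2.1

theorem contDiffAt_point : ∀ᶠ x in 𝓝 (0 : S.V), ContDiffAt ℝ ∞ S.point x := by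
  obtain ⟨⟨h0, hc, -⟩, hs, -⟩ := S.sectionMap_spec
  have ht : Tendsto (fun x : S.V => (x : E) + (sectionMap S.exp S.Q S.V S.h x : E)) (𝓝 0)
      (𝓝 0) := by
    have h1 : ContinuousAt (fun x : S.V => (x : E) + (sectionMap S.exp S.Q S.V S.h x : E)) 0 :=
      continuous_subtype_val.continuousAt.add (continuous_subtype_val.continuousAt.comp hc)
    have h2 := h1.tendsto
    simpa [h0] using h2
  filter_upwards [hs, ht.eventually S.isExp.1] with x h1 h2
  exact ContDiffAt.comp (g := S.exp)
    (f := fun x : S.V => (x : E) + (sectionMap S.exp S.Q S.V S.h x : E)) x h2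
    (S.V.subtypeL.contDiff.contDiffAt.add (S.h.subtypeL.contDiff.contDiffAt.comp x h1))

/-- The chain rule for `exp(x + φ x)`: as `dφ₀ = 0` and `d exp₀ = id`, the second derivative of `φ`,
which is `2R`, is simply added to that of `exp`. -/
theorem fderiv_point : fderiv ℝ S.point 0 = S.V.subtypeL ∧
    ∀ ξ η, fderiv ℝ (fderiv ℝ S.point) 0 ξ η =
      fderiv ℝ (fderiv ℝ S.exp) 0 ξ η + (2 : ℝ) • S.R ξ η := by
  obtain ⟨⟨h0, hc, -⟩, hs, hd⟩ := S.sectionMap_spec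
  set φ := sectionMap S.exp S.Q S.V S.h with hφ
  let j : S.V → E := fun x => S.V.subtypeL x + S.h.subtypeL (φ x)
  have hj0 : j 0 = 0 := by simp [j, h0]
  have hes := S.isExp.1
  have hjd : ∀ᶠ x in 𝓝 (0 : S.V),
      HasFDerivAt j (S.V.subtypeL + S.h.subtypeL.comp (fderiv ℝ φ x)) x :=
    hs.mono fun x hx => S.V.subtypeL.hasFDerivAt.add
      (S.h.subtypeL.hasFDerivAt.comp x hx.differentiableAt_of_smooth.hasFDerivAt)
  have hjs : ContDiffAt ℝ ∞ j 0 := S.V.subtypeL.contDiff.contDiffAt.add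
    (S.h.subtypeL.contDiff.contDiffAt.comp (0 : S.V) hs.self_of_nhds)
  have hjt : Tendsto j (𝓝 0) (𝓝 0) := by
    have := hjs.continuousAt.tendsto
    rwa [hj0] at this
  have hq : ∀ᶠ x in 𝓝 (0 : S.V), fderiv ℝ S.point x =
      (fderiv ℝ S.exp (j x)).comp (S.V.subtypeL + S.h.subtypeL.comp (fderiv ℝ φ x)) := by
    filter_upwards [hjd, hjt.eventually hes] with x h1 h2
    exact (h2.differentiableAt_of_smooth.hasFDerivAt.comp x h1).fderiv
  have hq0 : fderiv ℝ S.point 0 = S.V.subtypeL := by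
    rw [hq.self_of_nhds, hj0, S.isExp.2.2.1.fderiv, hd, ContinuousLinearMap.comp_zero, add_zero,
      ContinuousLinearMap.id_comp]
  refine ⟨hq0, fun ξ η => ?_⟩
  have hφs := hs.self_of_nhds
  have hdφ := hφs.fderiv_right (m := ∞) (by simp)
  have hde := hes.self_of_nhds.fderiv_right (m := ∞) (by simp)
  have hds := S.contDiffAt_point.self_of_nhds.fderiv_right (m := ∞) (by simp)
  have e : (fun x => fderiv ℝ S.point x η) =ᶠ[𝓝 0] fun x => fderiv ℝ S.exp (j x)
      (S.V.subtypeL η + S.h.subtypeL (fderiv ℝ φ x η)) :=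
    hq.mono fun x hx => DFunLike.congr_fun hx η
  have hej : ContDiffAt ℝ ∞ (fun x => fderiv ℝ S.exp (j x)) 0 :=
    (show ContDiffAt ℝ ∞ (fderiv ℝ S.exp) (j 0) by rwa [hj0]).comp (0 : S.V) hjs
  have hu : HasFDerivAt (fun x => S.V.subtypeL η + S.h.subtypeL (fderiv ℝ φ x η))
      (S.h.subtypeL.comp (fderiv ℝ (fun x => fderiv ℝ φ x η) 0)) 0 :=
    (S.h.subtypeL.hasFDerivAt.comp (0 : S.V) (contDiffAt_fderiv_apply hφs
      η).differentiableAt_of_smooth.hasFDerivAt).const_add _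
  have h3 : fderiv ℝ (fun x => fderiv ℝ S.exp (j x) (S.V.subtypeL η)) 0 ξ =
      fderiv ℝ (fderiv ℝ S.exp) 0 ξ η := by
    have ha : HasFDerivAt (fun g => fderiv ℝ S.exp g (S.V.subtypeL η))
        (fderiv ℝ (fun g => fderiv ℝ S.exp g (S.V.subtypeL η)) 0) (j 0) := by
      rw [hj0]
      exact (hde.clm_apply contDiffAt_const).differentiableAt_of_smooth.hasFDerivAt
    have hb := DFunLike.congr_fun (ha.comp (0 : S.V) hjd.self_of_nhds).fderiv ξ
    rw [hd] at hb
    refine hb.trans ?_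
    rw [ContinuousLinearMap.comp_apply, fderiv_apply_const hde.differentiableAt_of_smooth]
    simp
  have hR : (2 : ℝ) • S.R ξ η = (fderiv ℝ (fderiv ℝ φ) 0 ξ η : E) := by
    rw [R, sectionR, ← hφ, Submodule.coe_smul, smul_smul]
    norm_num
  rw [← fderiv_apply_const hds.differentiableAt_of_smooth, e.fderiv_eq,
    fderiv_clm_apply_eq_add hej.differentiableAt_of_smooth hu.differentiableAt, hu.fderiv, hj0,
    S.isExp.2.2.1.fderiv, hd, hR, ← fderiv_apply_const hdφ.differentiableAt_of_smooth, ← h3]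
  simp

/-- The second order term of the section, in terms of the bracket and of `R`. -/
theorem sectionSnd_point (ξ η : S.V) :
    sectionSnd S.G S.point ξ η =
      (1 / 2 : ℝ) • S.G.bracketL ξ η + (2 : ℝ) • S.R ξ η := by
  rw [sectionSnd_apply, S.fderiv_point.2, S.fderiv_point.1, S.isExp.fderiv_fderiv,
    S.G.bracketL_apply]
  simp only [Submodule.subtypeL_apply]
  module

end LoopInGroup

end SectionMap

/-! ### Projections parallel to a local subgroup and the action on cosets -/

section Coset

variable {E W : Type*} [NormedAddCommGroup E] [NormedSpace ℝ E]
  [NormedAddCommGroup W] [NormedSpace ℝ W]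

/-- `π` is, near the unit, the smooth projection on the section `q` parallel to the local subgroup
`K`. -/
structure IsSmoothCosetProj (G : LocalLieGroup E) (K : Set E) (q : W → E) (π : E → W) : Prop where
  smooth : ∀ᶠ g in 𝓝 (0 : E), ContDiffAt ℝ ∞ π g
  map_zero : π 0 = 0
  mem_iff : ∀ᶠ z in 𝓝 (0 : W × E), G.mul (G.inv (q z.1)) z.2 ∈ K ↔ z.1 = π z.2
  mul_mem : ∀ᶠ p in 𝓝 (0 : E × E), p.1 ∈ K → p.2 ∈ K → G.mul p.1 p.2 ∈ K

theorem ContDiffAt.tendsto_zero {f : E → W} (hf : ContDiffAt ℝ ∞ f 0) (h0 : f 0 = 0) :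
    Tendsto f (𝓝 0) (𝓝 0) := by
  have := hf.continuousAt.tendsto
  rwa [h0] at this

namespace IsSmoothCosetProj

variable {G : LocalLieGroup E} {K : Set E} {q : W → E} {π : E → W}

theorem tendsto (h : IsSmoothCosetProj G K q π) : Tendsto π (𝓝 0) (𝓝 0) :=
  h.smooth.self_of_nhds.tendsto_zero h.map_zero

theorem zero_mem (h : IsSmoothCosetProj G K q π) (hq0 : q 0 = 0) : (0 : E) ∈ K := by
  have := h.mem_iff.self_of_nhds.2 h.map_zero.symm
  rwa [Prod.fst_zero, Prod.snd_zero, hq0, G.inv_zero, G.mul_zero_zero] at this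

theorem eventually_mem (h : IsSmoothCosetProj G K q π) :
    ∀ᶠ g in 𝓝 (0 : E), G.mul (G.inv (q (π g))) g ∈ K :=
  ((h.tendsto.prodMk_nhds tendsto_id).eventually h.mem_iff).mono fun _ hg => hg.2 rfl

theorem apply_section (h : IsSmoothCosetProj G K q π) (hq : Tendsto q (𝓝 0) (𝓝 0)) (hq0 : q 0 = 0) :
    ∀ᶠ x in 𝓝 (0 : W), π (q x) = x := by
  have ht : Tendsto (fun x => (x, q x)) (𝓝 0) (𝓝 (0 : W × E)) := tendsto_id.prodMk_nhds hq
  filter_upwards [ht.eventually h.mem_iff, hq.eventually G.inv_mul] with x h1 h2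
  exact (h1.1 (by rw [h2]; exact h.zero_mem hq0)).symm

/-- The projection is constant on the cosets of `K`. -/
theorem apply_mul (h : IsSmoothCosetProj G K q π) (hq : Tendsto q (𝓝 0) (𝓝 0)) :
    ∀ᶠ p in 𝓝 (0 : E × E), p.2 ∈ K → π (G.mul p.1 p.2) = π p.1 := by
  have h1 : Tendsto (Prod.fst : E × E → E) (𝓝 0) (𝓝 0) := continuousAt_fst
  have h2 : Tendsto (Prod.snd : E × E → E) (𝓝 0) (𝓝 0) := continuousAt_snd
  have hπ := h.tendsto.comp h1
  have hi := G.tendsto_inv (hq.comp hπ)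
  filter_upwards [h1.eventually h.eventually_mem, G.eventually_assoc hi h1 h2,
    ((G.tendsto_mul hi h1).prodMk_nhds h2).eventually h.mul_mem,
    (hπ.prodMk_nhds (G.tendsto_mul h1 h2)).eventually h.mem_iff] with p a1 a2 a3 a4 hp
  have := a3 a1 hp
  rw [a2] at this
  exact (a4.1 this).symm

/-- The local group acts on its coset space. -/
theorem isLocalAction (h : IsSmoothCosetProj G K q π)
    (hq : ∀ᶠ x in 𝓝 (0 : W), ContDiffAt ℝ ∞ q x) (hq0 : q 0 = 0) :
    G.IsLocalAction (fun p : E × W => π (G.mul p.1 (q p.2))) where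
  smooth := by
    have h1 : Tendsto (Prod.fst : E × W → E) (𝓝 0) (𝓝 0) := continuousAt_fst
    have h2 : Tendsto (Prod.snd : E × W → W) (𝓝 0) (𝓝 0) := continuousAt_snd
    have hqt := (hq.self_of_nhds.tendsto_zero hq0).comp h2
    filter_upwards [(h1.prodMk_nhds hqt).eventually G.smooth_mul, h2.eventually hq,
      (G.tendsto_mul h1 hqt).eventually h.smooth] with p a1 a2 a3
    have hin : ContDiffAt ℝ ∞ (fun p : E × W => (p.1, q p.2)) p :=
      contDiffAt_fst.prodMk (a2.comp p contDiffAt_snd)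
    have hm : ContDiffAt ℝ ∞ (fun p : E × W => G.mul p.1 (q p.2)) p :=
      ContDiffAt.comp (g := fun p : E × E => G.mul p.1 p.2) (f := fun p : E × W => (p.1, q p.2))
        p a1 hin
    exact ContDiffAt.comp (g := π) (f := fun p : E × W => G.mul p.1 (q p.2)) p a3 hm
  zero_act := by
    have hqt := hq.self_of_nhds.tendsto_zero hq0
    filter_upwards [h.apply_section hqt hq0, hqt.eventually G.one_mul] with y h1 h2
    rw [h2, h1]
  act_act := by
    have hqt := hq.self_of_nhds.tendsto_zero hq0
    have h1 : Tendsto (fun z : E × E × W => z.1) (𝓝 0) (𝓝 0) := continuousAt_fst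
    have h2 : Tendsto (fun z : E × E × W => z.2.1) (𝓝 0) (𝓝 0) :=
      (continuous_fst.comp continuous_snd).tendsto' _ _ rfl
    have h3 : Tendsto (fun z : E × E × W => z.2.2) (𝓝 0) (𝓝 0) :=
      (continuous_snd.comp continuous_snd).tendsto' _ _ rfl
    have hy := hqt.comp h3
    have hc := G.tendsto_mul h2 hy
    have hv := hqt.comp (h.tendsto.comp hc)
    have hk := G.tendsto_mul (G.tendsto_inv hv) hc
    -- With `v = π(h·q y)` one has `h·q y = q v·k` for some `k ∈ K`, so `g·h·q y = (g·q v)·k`, and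
    -- `π` does not see `k`.
    filter_upwards [G.eventually_assoc h1 h2 hy, G.eventually_assoc h1 hv hk,
      G.eventually_mul_inv_cancel hv hc, hc.eventually h.eventually_mem,
      ((G.tendsto_mul h1 hv).prodMk_nhds hk).eventually (h.apply_mul hqt)] with z a1 a2 a3 a4 a5
    have := a5 a4
    rw [a2, a3] at this
    simp only [Function.comp_apply] at *
    rw [a1, this]

theorem fderiv_section (h : IsSmoothCosetProj G K q π)
    (hq : ∀ᶠ x in 𝓝 (0 : W), ContDiffAt ℝ ∞ q x) (hq0 : q 0 = 0) (ξ : W) :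
    fderiv ℝ π 0 (fderiv ℝ q 0 ξ) = ξ := by
  have h1 : HasFDerivAt π (fderiv ℝ π 0) (q 0) := by
    rw [hq0]; exact h.smooth.self_of_nhds.differentiableAt_of_smooth.hasFDerivAt
  have h2 := (h1.comp (0 : W) hq.self_of_nhds.differentiableAt_of_smooth.hasFDerivAt).unique
    ((hasFDerivAt_id (0 : W)).congr_of_eventuallyEq
      (h.apply_section (hq.self_of_nhds.tendsto_zero hq0) hq0))
  exact DFunLike.congr_fun h2 ξ

end IsSmoothCosetProj

theorem actField_coset_zero (G : LocalLieGroup E) {q : W → E} (hq0 : q 0 = 0) (π : E → W) :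
    actField (fun p : E × W => π (G.mul p.1 (q p.2))) 0 = fderiv ℝ π 0 := by
  refine Filter.EventuallyEq.fderiv_eq ?_
  filter_upwards [G.mul_one] with g hg
  rw [hq0, hg]

variable {G : LocalLieGroup E} {K : Set E} {V : Submodule ℝ E} {q : V → E} {π : E → V}

/-- `mem_iff` leaves only one small solution `v` of `g ∈ q(v)K`, so continuity at the unit fixes the
germ of the chosen projection. -/
theorem IsSmoothCosetProj.cosetProj_eventuallyEq (h : IsSmoothCosetProj G K q π) :
    cosetProj G K q =ᶠ[𝓝 0] π := by
  have hs : IsCosetProj G K q (cosetProj G K q) := Classical.epsilon_spec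
    ⟨π, h.map_zero, h.smooth.self_of_nhds.continuousAt, h.eventually_mem⟩
  obtain ⟨h0, hc, hm⟩ := hs
  have ht : Tendsto (cosetProj G K q) (𝓝 0) (𝓝 0) := by
    have := hc.tendsto
    rwa [h0] at this
  filter_upwards [hm, (ht.prodMk_nhds tendsto_id).eventually h.mem_iff] with g h1 h2
  exact h2.1 h1

theorem IsSmoothCosetProj.cosetProj (h : IsSmoothCosetProj G K q π) :
    IsSmoothCosetProj G K q (cosetProj G K q) where
  smooth := by
    filter_upwards [h.smooth, h.cosetProj_eventuallyEq.eventuallyEq_nhds] with g h1 h2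
    exact h1.congr_of_eventuallyEq h2
  map_zero := h.cosetProj_eventuallyEq.self_of_nhds.trans h.map_zero
  mem_iff := by
    have h2 : Tendsto (Prod.snd : V × E → E) (𝓝 0) (𝓝 0) := continuousAt_snd
    filter_upwards [h.mem_iff, h2.eventually h.cosetProj_eventuallyEq] with z h1 h2
    rw [h1, h2]
  mul_mem := h.mul_mem

end Coset

/-! ### Existence of the projections parallel to `H` and to its conjugates -/

section CosetExistence

variable {E X : Type*} [NormedAddCommGroup E] [NormedSpace ℝ E]
  [NormedAddCommGroup X] [NormedSpace ℝ X]

theorem LocalLieGroup.eventually_contDiffAt_mul (G : LocalLieGroup E) {a b : X → E}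
    (ha : ∀ᶠ x in 𝓝 (0 : X), ContDiffAt ℝ ∞ a x) (ha0 : a 0 = 0)
    (hb : ∀ᶠ x in 𝓝 (0 : X), ContDiffAt ℝ ∞ b x) (hb0 : b 0 = 0) :
    ∀ᶠ x in 𝓝 (0 : X), ContDiffAt ℝ ∞ (fun x => G.mul (a x) (b x)) x := by
  have ht := (ha.self_of_nhds.tendsto_zero ha0).prodMk_nhds (hb.self_of_nhds.tendsto_zero hb0)
  filter_upwards [ha, hb, ht.eventually G.smooth_mul] with x h1 h2 h3
  exact ContDiffAt.comp (g := fun p : E × E => G.mul p.1 p.2) (f := fun x => (a x, b x)) x h3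
    (h1.prodMk h2)

theorem LocalLieGroup.eventually_contDiffAt_inv (G : LocalLieGroup E) {a : X → E}
    (ha : ∀ᶠ x in 𝓝 (0 : X), ContDiffAt ℝ ∞ a x) (ha0 : a 0 = 0) :
    ∀ᶠ x in 𝓝 (0 : X), ContDiffAt ℝ ∞ (fun x => G.inv (a x)) x := by
  filter_upwards [ha, (ha.self_of_nhds.tendsto_zero ha0).eventually G.smooth_inv] with x h1 h2
  exact h2.comp x h1

/-- A conjugate of a local subgroup is closed under products near the unit. -/
theorem LocalLieGroup.eventually_conjSubgroup_mul_mem (G : LocalLieGroup E) {H : Set E}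
    (hH : ∀ᶠ p in 𝓝 (0 : E × E), p.1 ∈ H → p.2 ∈ H → G.mul p.1 p.2 ∈ H) :
    ∀ᶠ z in 𝓝 ((0 : E), (0 : E × E)), z.2.1 ∈ G.conjSubgroup H z.1 →
      z.2.2 ∈ G.conjSubgroup H z.1 → G.mul z.2.1 z.2.2 ∈ G.conjSubgroup H z.1 := by
  have hu : Tendsto (fun z : E × E × E => z.1) (𝓝 (0, 0)) (𝓝 0) := continuousAt_fst
  have hx : Tendsto (fun z : E × E × E => z.2.1) (𝓝 (0, 0)) (𝓝 0) :=
    (continuous_fst.comp continuous_snd).tendsto' _ _ rfl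
  have hy : Tendsto (fun z : E × E × E => z.2.2) (𝓝 (0, 0)) (𝓝 0) :=
    (continuous_snd.comp continuous_snd).tendsto' _ _ rfl
  have hi := G.tendsto_inv hu
  have hix := G.tendsto_mul hi hx
  have hiy := G.tendsto_mul hi hy
  have hyu := G.tendsto_mul hy hu
  have hk := G.tendsto_mul hiy hu
  -- This is `(u⁻¹xu)(u⁻¹yu) = u⁻¹(xy)u`, with each reassociation justified near the unit.
  filter_upwards [((G.tendsto_mul hix hu).prodMk_nhds hk).eventually hH,
    G.eventually_assoc hix hu hk, G.eventually_assoc hi hy hu,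
    G.eventually_mul_inv_cancel hu hyu, G.eventually_assoc hix hy hu,
    G.eventually_assoc hi hx hy] with z a1 a2 a3 a4 a5 a6 m1 m2
  have := a1 m1 m2
  rw [a2, a3, a4, ← a5, a6] at this
  exact this

end CosetExistence

namespace LoopInGroup

variable {E : Type*} [NormedAddCommGroup E] [NormedSpace ℝ E] [FiniteDimensional ℝ E]
  (S : LoopInGroup E)

theorem tendsto_point : Tendsto S.point (𝓝 0) (𝓝 0) :=
  S.contDiffAt_point.self_of_nhds.tendsto_zero S.point_zero

/-- The projections on the section parallel to the conjugates of `H`, and to `H` itself. -/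
theorem exists_isSmoothCosetProj :
    (∀ᶠ u in 𝓝 (0 : E), ∃ π : E → S.V,
      IsSmoothCosetProj S.G (S.G.conjSubgroup S.H u) S.point π) ∧
    ∃ π : E → S.V, IsSmoothCosetProj S.G S.H S.point π ∧
      fderiv ℝ π 0 = complProj S.V S.h S.isCompl := by
  obtain ⟨⟨Ψ, hΨs, hΨ0, hΨd, hΨ⟩, hHm, -⟩ := S.isLocalSubgroup
  set G := S.G
  set q := S.point
  have hq : ∀ᶠ x in 𝓝 (0 : S.V), ContDiffAt ℝ ∞ q x := S.contDiffAt_point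
  have hq0 : q 0 = 0 := S.point_zero
  have hqt : Tendsto q (𝓝 0) (𝓝 0) := S.tendsto_point
  have hqd : HasFDerivAt q S.V.subtypeL 0 := by
    rw [← S.fderiv_point.1]
    exact hq.self_of_nhds.differentiableAt_of_smooth.hasFDerivAt
  let pr := complProj S.V S.h S.isCompl
  -- `κ(v, g, u) = u⁻¹(q(v)⁻¹g)u` lies in `H` exactly when `q(v)⁻¹g` lies in `uHu⁻¹`. With `u` as a
  -- parameter, one implicit function serves all small conjugates, and `u = 0` gives `H`.
  let κ : S.V × E × E → E := fun z =>
    G.mul (G.mul (G.inv z.2.2) (G.mul (G.inv (q z.1)) z.2.1)) z.2.2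
  have hv : Tendsto (fun z : S.V × E × E => z.1) (𝓝 0) (𝓝 0) := continuousAt_fst
  have hκ : ∀ᶠ z in 𝓝 (0 : S.V × E × E), ContDiffAt ℝ ∞ κ z := by
    have s1 : ∀ᶠ z in 𝓝 (0 : S.V × E × E), ContDiffAt ℝ ∞ (fun z : S.V × E × E => q z.1) z :=
      (hv.eventually hq).mono fun z hz => hz.comp z contDiffAt_fst
    have s2 : ∀ᶠ z in 𝓝 (0 : S.V × E × E), ContDiffAt ℝ ∞ (fun z : S.V × E × E => z.2.1) z :=
      Eventually.of_forall fun z => (contDiff_fst.comp contDiff_snd).contDiffAt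
    have s3 : ∀ᶠ z in 𝓝 (0 : S.V × E × E), ContDiffAt ℝ ∞ (fun z : S.V × E × E => z.2.2) z :=
      Eventually.of_forall fun z => (contDiff_snd.comp contDiff_snd).contDiffAt
    refine G.eventually_contDiffAt_mul (G.eventually_contDiffAt_mul
      (G.eventually_contDiffAt_inv s3 rfl) G.inv_zero (G.eventually_contDiffAt_mul
      (G.eventually_contDiffAt_inv s1 hq0) ?_ s2 rfl) ?_) ?_ s3 rfl
    · rw [Prod.fst_zero, hq0, G.inv_zero]
    · simp only [Prod.fst_zero, Prod.snd_zero, hq0, G.inv_zero, G.mul_zero_zero]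
    · simp only [Prod.fst_zero, Prod.snd_zero, hq0, G.inv_zero, G.mul_zero_zero]
  have hκ0 : κ 0 = 0 := by
    simp only [κ, Prod.fst_zero, Prod.snd_zero, hq0, G.inv_zero, G.mul_zero_zero]
  have hκt := hκ.self_of_nhds.tendsto_zero hκ0
  -- The sign compensates the differential `-id` of the inversion, so that the derivative of `Φ` in
  -- `v` is the identity.
  let Φ : S.V × E × E → S.V := fun z => -pr (Ψ (κ z))
  have hΦs : ∀ᶠ z in 𝓝 (0 : S.V × E × E), ContDiffAt ℝ ∞ Φ z := by
    filter_upwards [hκ, hκt.eventually hΨs] with z h1 h2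
    exact (pr.contDiff.contDiffAt.comp z (h2.comp z h1)).neg
  have hΦ0 : Φ 0 = 0 := by simp only [Φ, hκ0, hΨ0, map_zero, neg_zero]
  have hΦd := hΦs.self_of_nhds.differentiableAt_of_smooth
  have hΦv (v : S.V) : fderiv ℝ Φ 0 (v, 0) = v := by
    have h1 := DFunLike.congr_fun (fderiv_comp_left hΦd) v
    refine h1.symm.trans ?_
    have e : (fun v : S.V => Φ (v, 0)) =ᶠ[𝓝 0] fun v => -pr (Ψ (G.inv (q v))) := by
      have hi := G.tendsto_inv hqt
      filter_upwards [hi.eventually G.mul_one, hi.eventually G.one_mul] with v h1 h2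
      simp only [Φ, κ, Prod.fst_zero, Prod.snd_zero, G.inv_zero, h1, h2]
    have hi : HasFDerivAt G.inv (-ContinuousLinearMap.id ℝ E) (q 0) := by
      rw [hq0]; exact G.hasFDerivAt_inv
    have hiq : HasFDerivAt (fun v => G.inv (q v)) (-S.V.subtypeL) 0 := by
      have := hi.comp (0 : S.V) hqd
      rwa [ContinuousLinearMap.neg_comp, ContinuousLinearMap.id_comp] at this
    have hΨ' : HasFDerivAt Ψ (ContinuousLinearMap.id ℝ E) (G.inv (q 0)) := by
      rwa [hq0, G.inv_zero]
    have hΨi : HasFDerivAt (fun v => Ψ (G.inv (q v))) (-S.V.subtypeL) 0 :=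
      HasFDerivAt.comp (g := Ψ) (f := fun v => G.inv (q v)) 0 hΨ' hiq
    have h2 : HasFDerivAt (fun v => -pr (Ψ (G.inv (q v)))) (-(pr.comp (-S.V.subtypeL))) 0 :=
      (pr.hasFDerivAt.comp (0 : S.V) hΨi).neg
    have h3 := DFunLike.congr_fun (e.fderiv_eq.trans h2.fderiv) v
    refine Eq.trans h3 ?_
    rw [neg_apply, ContinuousLinearMap.comp_apply, neg_apply, map_neg, neg_neg]
    exact complProj_coe S.isCompl v
  have hΦg (g : E) : fderiv ℝ Φ 0 (0, g, 0) = -pr g := by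
    have e : (fun g : E => Φ (0, g, 0)) =ᶠ[𝓝 0] fun g => -pr (Ψ g) := by
      filter_upwards [G.mul_one, G.one_mul] with g h1 h2
      simp only [Φ, κ, hq0, G.inv_zero, h1, h2]
    have hin : HasFDerivAt (fun g : E => ((0 : S.V), g, (0 : E)))
        ((ContinuousLinearMap.inr ℝ S.V (E × E)).comp (ContinuousLinearMap.inl ℝ E E)) 0 :=
      ((ContinuousLinearMap.inr ℝ S.V (E × E)).comp
        (ContinuousLinearMap.inl ℝ E E)).hasFDerivAt
    have h1 : HasFDerivAt (fun g : E => Φ (0, g, 0)) ((fderiv ℝ Φ 0).comp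
        ((ContinuousLinearMap.inr ℝ S.V (E × E)).comp (ContinuousLinearMap.inl ℝ E E))) 0 :=
      HasFDerivAt.comp (g := Φ) (f := fun g : E => ((0 : S.V), g, (0 : E))) 0 hΦd.hasFDerivAt hin
    have h2 : HasFDerivAt (fun g => -pr (Ψ g)) (-(pr.comp (ContinuousLinearMap.id ℝ E))) 0 :=
      (pr.hasFDerivAt.comp (0 : E) hΨd).neg
    exact DFunLike.congr_fun (h1.unique (h2.congr_of_eventuallyEq e)) g
  obtain ⟨pj, hps, hp0, hpj⟩ := exists_smooth_implicit hΦs hΦ0 hΦv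
  have hmem : ∀ᶠ z in 𝓝 (0 : S.V × E × E), κ z ∈ S.H ↔ z.1 = pj z.2 := by
    filter_upwards [hκt.eventually hΨ, hpj] with z h1 h2
    rw [h1, ← h2, ← complProj_eq_zero_iff S.isCompl, ← neg_eq_zero]
  have h0H : (0 : E) ∈ S.H := hΨ.self_of_nhds.2 (by rw [hΨ0]; exact zero_mem _)
  constructor
  · have hsw : Tendsto (fun z : E × E => (z.2, z.1)) (𝓝 (0, 0)) (𝓝 (0 : E × E)) :=
      continuous_swap.tendsto' _ _ rfl
    have hsw' : Tendsto (fun z : E × S.V × E => (z.2.1, z.2.2, z.1)) (𝓝 (0, 0))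
        (𝓝 (0 : S.V × E × E)) := by
      have : Continuous (fun z : E × S.V × E => (z.2.1, z.2.2, z.1)) := by fun_prop
      exact this.tendsto' _ _ rfl
    filter_upwards [(hsw.eventually hps).curry_nhds, (hsw'.eventually hmem).curry_nhds,
      (G.eventually_conjSubgroup_mul_mem hHm).curry_nhds, G.inv_mul,
      (G.tendsto_inv tendsto_id).eventually G.mul_one] with u a1 a2 a3 a4 a5
    refine ⟨fun g => pj (g, u), ?_, ?_, a2, a3⟩
    · filter_upwards [a1] with g hg
      exact hg.comp g (contDiffAt_id.prodMk contDiffAt_const)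
    · have h := a2.self_of_nhds.1
      refine (h ?_).symm
      show κ (0, 0, u) ∈ S.H
      simp only [κ, hq0, G.inv_zero, G.mul_zero_zero]
      rw [show G.mul (G.inv u) 0 = G.inv u from a5, a4]
      exact h0H
  · have hin : Tendsto (fun g : E => (g, (0 : E))) (𝓝 0) (𝓝 (0 : E × E)) :=
      (Continuous.prodMk_left (0 : E)).tendsto' _ _ rfl
    have hin' : Tendsto (fun z : S.V × E => (z.1, z.2, (0 : E))) (𝓝 0) (𝓝 (0 : S.V × E × E)) := by
      have : Continuous (fun z : S.V × E => (z.1, z.2, (0 : E))) := by fun_prop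
      exact this.tendsto' _ _ rfl
    have hπs : ∀ᶠ g in 𝓝 (0 : E), ContDiffAt ℝ ∞ (fun g => pj (g, (0 : E))) g :=
      (hin.eventually hps).mono fun g hg => hg.comp g (contDiffAt_id.prodMk contDiffAt_const)
    refine ⟨fun g => pj (g, 0), ⟨hπs, hp0, ?_, hHm⟩, ?_⟩
    · have h1 : Tendsto (Prod.fst : S.V × E → S.V) (𝓝 0) (𝓝 0) := continuousAt_fst
      have h2 : Tendsto (Prod.snd : S.V × E → E) (𝓝 0) (𝓝 0) := continuousAt_snd
      have hx := G.tendsto_mul (G.tendsto_inv (hqt.comp h1)) h2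
      filter_upwards [hin'.eventually hmem, hx.eventually G.one_mul,
        hx.eventually G.mul_one] with z a1 a2 a3
      simp only [Function.comp_apply] at a2 a3
      simp only [κ, G.inv_zero, a2, a3] at a1
      exact a1
    · have hpd := hπs.self_of_nhds.differentiableAt_of_smooth.hasFDerivAt
      have hgr : HasFDerivAt (fun g : E => (pj (g, (0 : E)), g, (0 : E)))
          ((fderiv ℝ (fun g => pj (g, (0 : E))) 0).prod (ContinuousLinearMap.inl ℝ E E)) 0 :=
        hpd.prodMk (ContinuousLinearMap.inl ℝ E E).hasFDerivAt
      have hgt : Tendsto (fun g : E => (pj (g, (0 : E)), g, (0 : E))) (𝓝 0)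
          (𝓝 (0 : S.V × E × E)) := by
        have h : Tendsto (fun g : E => (pj (g, (0 : E)), g, (0 : E))) (𝓝 0)
          (𝓝 (pj 0, 0, 0)) := hgr.continuousAt.tendsto
        rwa [hp0] at h
      have hz : ∀ᶠ g in 𝓝 (0 : E), Φ (pj (g, (0 : E)), g, (0 : E)) = 0 :=
        (hgt.eventually hpj).mono fun g hg => hg.2 rfl
      have hΦ' : HasFDerivAt Φ (fderiv ℝ Φ 0) (pj ((0 : E), (0 : E)), (0 : E), (0 : E)) := by
        have : pj ((0 : E), (0 : E)) = 0 := hp0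
        rw [this]; exact hΦd.hasFDerivAt
      have hc := HasFDerivAt.comp (g := Φ) (f := fun g : E => (pj (g, (0 : E)), g, (0 : E))) 0
        hΦ' hgr
      have h := hc.unique ((hasFDerivAt_const (0 : S.V) (0 : E)).congr_of_eventuallyEq hz)
      ext1 g
      have hg : fderiv ℝ Φ 0 (fderiv ℝ (fun g => pj (g, (0 : E))) 0 g, g, 0) = 0 :=
        DFunLike.congr_fun h g
      have hsplit : ((fderiv ℝ (fun g => pj (g, (0 : E))) 0 g, g, 0) : S.V × E × E) =
          (fderiv ℝ (fun g => pj (g, (0 : E))) 0 g, 0) + (0, g, 0) := by simp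
      rw [hsplit, map_add, hΦv, hΦg, ← sub_eq_add_neg, sub_eq_zero] at hg
      exact hg

end LoopInGroup

/-! ### Conjugates of `H` and the derivative of the curvature along them -/

namespace LoopInGroup

variable {E : Type*} [NormedAddCommGroup E] [NormedSpace ℝ E]
  (S : LoopInGroup E)

/-- The coordinate of the projection on `Q` parallel to `H`. -/
noncomputable def proj : E → S.V := cosetProj S.G S.H S.point

/-- The action of the local group on `Q`, seen as the space of left cosets of `H`. -/
noncomputable def act (p : E × S.V) : S.V := S.proj (S.G.mul p.1 (S.point p.2))

/-- The map `(g, u) ↦ g u`, followed by the projection on `Q`. -/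
noncomputable def projMul (p : E × E) : S.V := S.proj (S.G.mul p.1 p.2)

theorem law_eq_actLaw : S.law = actLaw S.act S.point := rfl

/-- At `u = q y` the data governing the projection parallel to `uHu⁻¹` are those of the action at
the point `y`; this links `bConj` to `d`. -/
theorem actField_projMul_point (y : S.V) : actField S.projMul (S.point y) = actField S.act y := rfl

variable [FiniteDimensional ℝ E]

theorem isSmoothCosetProj_proj : IsSmoothCosetProj S.G S.H S.point S.proj := by
  obtain ⟨-, π, hπ, -⟩ := S.exists_isSmoothCosetProj
  exact hπ.cosetProj

theorem fderiv_proj : fderiv ℝ S.proj 0 = complProj S.V S.h S.isCompl := by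
  obtain ⟨-, π, hπ, hd⟩ := S.exists_isSmoothCosetProj
  rw [← hd]
  exact hπ.cosetProj_eventuallyEq.fderiv_eq

theorem isLocalAction_act : S.G.IsLocalAction S.act :=
  S.isSmoothCosetProj_proj.isLocalAction S.contDiffAt_point S.point_zero

theorem actField_act_zero : actField S.act 0 = complProj S.V S.h S.isCompl :=
  (actField_coset_zero S.G S.point_zero S.proj).trans S.fderiv_proj

theorem actField_act_section (ξ : S.V) : actField S.act 0 (fderiv ℝ S.point 0 ξ) = ξ := by
  rw [S.actField_act_zero, S.fderiv_point.1]
  exact complProj_coe S.isCompl ξ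

theorem eventually_contDiffAt_projMul :
    ∀ᶠ p in 𝓝 (0 : E × E), ContDiffAt ℝ ∞ S.projMul p := by
  have h1 : Tendsto (Prod.fst : E × E → E) (𝓝 0) (𝓝 0) := continuousAt_fst
  have h2 : Tendsto (Prod.snd : E × E → E) (𝓝 0) (𝓝 0) := continuousAt_snd
  filter_upwards [S.G.smooth_mul,
    (S.G.tendsto_mul h1 h2).eventually S.isSmoothCosetProj_proj.smooth] with p a1 a2
  exact ContDiffAt.comp (g := S.proj) (f := fun p : E × E => S.G.mul p.1 p.2) p a2 a1

theorem contDiffAt_actField_projMul : ContDiffAt ℝ ∞ (actField S.projMul) 0 :=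
  contDiffAt_actField S.eventually_contDiffAt_projMul.self_of_nhds

theorem actField_projMul_zero : actField S.projMul 0 = actField S.act 0 := by
  rw [← S.actField_projMul_point, S.point_zero]

theorem eventually_isInvertible_projMul :
    ∀ᶠ u in 𝓝 (0 : E), ((actField S.projMul u).comp (fderiv ℝ S.point 0)).IsInvertible :=
  eventually_isInvertible (S.contDiffAt_actField_projMul.continuousAt.clm_comp continuousAt_const)
    (by rw [S.actField_projMul_zero]; exact ContinuousLinearMap.ext S.actField_act_section)

/-- The cosets of `u H u⁻¹` are translates of those of `H`. -/
theorem proj_mul_eq_of_mem_conjSubgroup :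
    ∀ᶠ z in 𝓝 ((0 : E), (0 : S.V × E)),
      S.G.mul (S.G.inv (S.point z.2.1)) z.2.2 ∈ S.G.conjSubgroup S.H z.1 →
        S.proj (S.G.mul z.2.2 z.1) = S.proj (S.G.mul (S.point z.2.1) z.1) := by
  have hu : Tendsto (fun z : E × S.V × E => z.1) (𝓝 (0, 0)) (𝓝 0) := continuousAt_fst
  have hv : Tendsto (fun z : E × S.V × E => z.2.1) (𝓝 (0, 0)) (𝓝 0) :=
    (continuous_fst.comp continuous_snd).tendsto' _ _ rfl
  have hg : Tendsto (fun z : E × S.V × E => z.2.2) (𝓝 (0, 0)) (𝓝 0) :=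
    (continuous_snd.comp continuous_snd).tendsto' _ _ rfl
  have hq : Tendsto (fun z : E × S.V × E => S.point z.2.1) (𝓝 (0, 0)) (𝓝 0) :=
    S.tendsto_point.comp hv
  have hi := S.G.tendsto_inv hu
  have hx := S.G.tendsto_mul (S.G.tendsto_inv hq) hg
  have hk := S.G.tendsto_mul (S.G.tendsto_mul hi hx) hu
  -- If `g = q(v)x` with `u⁻¹xu ∈ H`, then `gu = (q(v)u)(u⁻¹xu)` lies in the coset of `q(v)u`.
  filter_upwards [S.G.eventually_assoc hq hu hk, S.G.eventually_assoc hi hx hu,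
    S.G.eventually_mul_inv_cancel hu (S.G.tendsto_mul hx hu), S.G.eventually_assoc hq hx hu,
    S.G.eventually_mul_inv_cancel hq hg, ((S.G.tendsto_mul hq hu).prodMk_nhds hk).eventually
      (S.isSmoothCosetProj_proj.apply_mul S.tendsto_point)] with z a1 a2 a3 a4 a5 a6 hz
  have h := a6 hz
  rw [a1, a2, a3, ← a4, a5] at h
  exact h

/-- The differential at the unit of the projection parallel to `u H u⁻¹`. -/
theorem fderiv_conjProj : ∀ᶠ u in 𝓝 (0 : E), ∀ π : E → S.V,
    IsSmoothCosetProj S.G (S.G.conjSubgroup S.H u) S.point π →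
      fderiv ℝ π 0 = actProj S.projMul (fderiv ℝ S.point 0) u := by
  filter_upwards [S.proj_mul_eq_of_mem_conjSubgroup.curry_nhds, S.eventually_isInvertible_projMul,
    tendsto_zero_prodMk.eventually S.eventually_contDiffAt_projMul] with u hrel hinv hs π hπ
  have hs' : HasFDerivAt (fun g => S.projMul (g, u)) (actField S.projMul u) 0 :=
    ContDiffAt.differentiableAt_of_smooth (ContDiffAt.comp (g := S.projMul) (f := fun g => (g, u))
      0 hs (contDiffAt_id.prodMk contDiffAt_const)) |>.hasFDerivAt
  -- Differentiating this identity at the unit gives `ℓ = ℓ ∘ ι ∘ dπ₀`, where `ℓ = actField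
  -- S.projMul u`; inverting `ℓ ∘ ι` determines `dπ₀`.
  have e : (fun g => S.projMul (g, u)) =ᶠ[𝓝 0] fun g => S.projMul (S.point (π g), u) := by
    filter_upwards [(hπ.tendsto.prodMk_nhds tendsto_id).eventually hrel,
      hπ.eventually_mem] with g h1 h2
    exact h1 h2
  have hqd : HasFDerivAt S.point (fderiv ℝ S.point 0) (π 0) := by
    rw [hπ.map_zero]
    exact S.contDiffAt_point.self_of_nhds.differentiableAt_of_smooth.hasFDerivAt
  have hqπ : HasFDerivAt (fun g => S.point (π g)) ((fderiv ℝ S.point 0).comp (fderiv ℝ π 0)) 0 :=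
    hqd.comp (0 : E) hπ.smooth.self_of_nhds.differentiableAt_of_smooth.hasFDerivAt
  have hs'' : HasFDerivAt (fun g => S.projMul (g, u)) (actField S.projMul u)
      (S.point (π 0)) := by rwa [hπ.map_zero, S.point_zero]
  have h := hs'.unique (HasFDerivAt.congr_of_eventuallyEq
    (HasFDerivAt.comp (g := fun g => S.projMul (g, u)) (f := fun g => S.point (π g)) 0 hs'' hqπ) e)
  ext1 v
  exact (hinv.inverse_apply_eq.2 (DFunLike.congr_fun h v)).symm

/-- The curvature tensor of the loop given by the projection parallel to `u H u⁻¹`. -/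
theorem bConj_eq : ∀ᶠ u in 𝓝 (0 : E), ∀ ξ η ζ : S.V, S.bConj u ξ η ζ =
    -actProj S.projMul (fderiv ℝ S.point 0) u (S.G.bracketL (sectionSnd S.G S.point ξ η
      - fderiv ℝ S.point 0 (actProj S.projMul (fderiv ℝ S.point 0) u
        (sectionSnd S.G S.point ξ η))) (fderiv ℝ S.point 0 ζ)) := by
  filter_upwards [S.exists_isSmoothCosetProj.1, S.fderiv_conjProj] with u ⟨π₀, hπ₀⟩ hd ξ η ζ
  have hπ := hπ₀.cosetProj
  -- The conjugate loop is again the law of an action of `G` with the same section, so `sectionSnd`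
  -- is unchanged and only the projection varies with `u`.
  have hact := hπ.isLocalAction S.contDiffAt_point S.point_zero
  have h0 := actField_coset_zero S.G S.point_zero
    (cosetProj S.G (S.G.conjSubgroup S.H u) S.point)
  have h := webB_actLaw_zero hact S.contDiffAt_point S.point_zero
    (fun ξ => by rw [h0]; exact hπ.fderiv_section S.contDiffAt_point S.point_zero ξ) ξ η ζ
  rw [h0, hd _ hπ] at h
  exact h

theorem d_eq (ξ η ζ τ : S.V) : S.d ξ η ζ τ =
    actField S.act 0 (S.G.bracketL (fderiv ℝ S.point 0
        (fderiv ℝ (actProj S.act (fderiv ℝ S.point 0)) 0 τ (sectionSnd S.G S.point ξ η)))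
          (fderiv ℝ S.point 0 ζ))
      - fderiv ℝ (actProj S.act (fderiv ℝ S.point 0)) 0 τ
        (S.G.bracketL (sectionSnd S.G S.point ξ η
          - fderiv ℝ S.point 0 (actField S.act 0 (sectionSnd S.G S.point ξ η)))
            (fderiv ℝ S.point 0 ζ)) :=
  webNablaTwoB_actLaw S.isLocalAction_act S.contDiffAt_point S.point_zero
    S.actField_act_section ξ η ζ τ

/-- `d` is the derivative of the curvature tensor along the conjugates of `H`. -/
theorem hasDerivAt_bConj (ξ η ζ τ : S.V) :
    HasDerivAt (fun t : ℝ => S.bConj (S.exp (t • (τ : E))) ξ η ζ) (S.d ξ η ζ τ) 0 := by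
  obtain ⟨hes, he0, hed, -⟩ := S.isExp
  set ι := fderiv ℝ S.point 0 with hι
  have hF : ContDiffAt ℝ ∞ (actProj S.projMul ι) 0 :=
    (contDiffAt_inverse_apply (S.contDiffAt_actField_projMul.clm_comp contDiffAt_const)
      S.eventually_isInvertible_projMul.self_of_nhds).clm_comp S.contDiffAt_actField_projMul
  have hq := S.contDiffAt_point.self_of_nhds.differentiableAt_of_smooth.hasFDerivAt
  -- The projection at `y` is the one at `u = q y`, and `q` has differential `V ⊂ E` at `0`; so the
  -- curve `exp(tτ)` may replace the path in the section.
  have h1 : fderiv ℝ (actProj S.act ι) 0 τ = fderiv ℝ (actProj S.projMul ι) 0 (τ : E) := by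
    have ha : HasFDerivAt (actProj S.projMul ι) (fderiv ℝ (actProj S.projMul ι) 0)
        (S.point 0) := by
      rw [S.point_zero]; exact hF.differentiableAt_of_smooth.hasFDerivAt
    have hb : fderiv ℝ (actProj S.act ι) 0 =
        (fderiv ℝ (actProj S.projMul ι) 0).comp (fderiv ℝ S.point 0) :=
      (ha.comp (0 : S.V) hq).fderiv
    rw [hb, S.fderiv_point.1]
    rfl
  have hc : HasDerivAt (fun t : ℝ => actProj S.projMul ι (S.exp (t • (τ : E))))
      (fderiv ℝ (actProj S.act ι) 0 τ) 0 := by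
    have ha := hes.self_of_nhds.hasDerivAt_comp_smul (τ : E)
    rw [hed.fderiv] at ha
    have hb : HasFDerivAt (actProj S.projMul ι) (fderiv ℝ (actProj S.projMul ι) 0)
        (S.exp ((0 : ℝ) • (τ : E))) := by
      rw [zero_smul, he0]; exact hF.differentiableAt_of_smooth.hasFDerivAt
    rw [h1]
    exact hb.comp_hasDerivAt (0 : ℝ) ha
  have ht : Tendsto (fun t : ℝ => S.exp (t • (τ : E))) (𝓝 0) (𝓝 0) := by
    have := (hes.self_of_nhds.hasDerivAt_comp_smul (τ : E)).continuousAt.tendsto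
    rwa [zero_smul, he0] at this
  have e : (fun t : ℝ => S.bConj (S.exp (t • (τ : E))) ξ η ζ) =ᶠ[𝓝 0] _ :=
    (ht.eventually S.bConj_eq).mono fun t h => h ξ η ζ
  have hw := hc.clm_apply (hasDerivAt_const (0 : ℝ) (sectionSnd S.G S.point ξ η))
  have hA := (hasDerivAt_const (0 : ℝ) (sectionSnd S.G S.point ξ η)).sub
    (ι.hasFDerivAt.comp_hasDerivAt (0 : ℝ) hw)
  have hB := (S.G.bracketL.hasFDerivAt.comp_hasDerivAt (0 : ℝ) hA).clm_apply
    (hasDerivAt_const (0 : ℝ) (ι ζ))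
  have hD := (hc.clm_apply hB).neg
  have h0 : actProj S.projMul ι 0 = actField S.act 0 := by
    rw [← actProj_zero S.actField_act_section, ← hι]
    show _ = actProj S.projMul ι (S.point 0)
    rw [S.point_zero]
  refine (hD.congr_of_eventuallyEq e).congr_deriv ?_
  rw [S.d_eq, ← hι]
  simp only [Function.comp_apply, Pi.sub_apply, zero_smul, he0, h0, map_zero, add_zero, zero_sub,
    map_neg, neg_apply]
  abel

/-! ### The explicit formula and the alternation identity -/

theorem complProj_R (ξ η : S.V) : complProj S.V S.h S.isCompl (S.R ξ η) = 0 :=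
  (complProj_eq_zero_iff S.isCompl).2 (sectionR S.exp S.Q S.V S.h ξ η).2

/-- `d` in terms of the isotropy part of the second order term of the section. -/
theorem d_eq_complProj (ξ η ζ τ : S.V) {A : E} (hA : A = sectionSnd S.G S.point ξ η
      - (complProj S.V S.h S.isCompl (sectionSnd S.G S.point ξ η) : E)) :
    S.d ξ η ζ τ =
      complProj S.V S.h S.isCompl
        (S.G.bracketL (complProj S.V S.h S.isCompl (S.G.bracketL A τ)) ζ)
      - complProj S.V S.h S.isCompl (S.G.bracketL (S.G.bracketL A ζ
        - (complProj S.V S.h S.isCompl (S.G.bracketL A ζ) : E)) τ) := by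
  rw [S.d_eq, fderiv_actProj S.isLocalAction_act S.actField_act_section,
    fderiv_actProj S.isLocalAction_act S.actField_act_section, S.fderiv_point.1,
    S.actField_act_zero, hA]
  rfl

/-- Since `ΠR = 0`, the isotropy part of `w` is `A = ½([ξ,η] - Π[ξ,η]) + 2R(ξ,η)`; the nine terms
come from expanding `Π[Π[A,τ],ζ] - Π[[A,ζ] - Π[A,ζ], τ]`. -/
theorem d_formula (ξ η ζ τ : S.V) :
    (S.d ξ η ζ τ : E) =
        (1 / 2 : ℝ) • S.Pr (S.br τ (S.br (S.br ξ η) ζ))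
        - (1 / 2 : ℝ) • S.Pr (S.br τ (S.Pr (S.br (S.br ξ η) ζ)))
        - (1 / 2 : ℝ) • S.Pr (S.br τ (S.br (S.Pr (S.br ξ η)) ζ))
        + (1 / 2 : ℝ) • S.Pr (S.br τ (S.Pr (S.br (S.Pr (S.br ξ η)) ζ)))
        - (1 / 2 : ℝ) • S.Pr (S.br (S.Pr (S.br τ (S.br ξ η))) ζ)
        + (1 / 2 : ℝ) • S.Pr (S.br (S.Pr (S.br τ (S.Pr (S.br ξ η)))) ζ)
        + (2 : ℝ) • S.Pr (S.br τ (S.br (S.R ξ η) ζ))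
        - (2 : ℝ) • S.Pr (S.br τ (S.Pr (S.br (S.R ξ η) ζ)))
        - (2 : ℝ) • S.Pr (S.br (S.Pr (S.br τ (S.R ξ η))) ζ) := by
  have hbr (x y : E) : S.br x y = S.G.bracketL x y := S.G.bracket_eq x y
  have hPr (x : E) : S.Pr x = (complProj S.V S.h S.isCompl x : E) := rfl
  rw [S.d_eq_complProj ξ η ζ τ rfl, S.sectionSnd_point, S.G.bracketL_swap _ (τ : E),
    S.G.bracketL_swap _ (τ : E)]
  simp only [hbr, hPr, map_add, map_sub, map_smul, map_neg, S.complProj_R, smul_zero, add_zero,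
    add_apply, sub_apply, neg_apply, smul_apply, Submodule.coe_add, Submodule.coe_sub,
    Submodule.coe_neg, Submodule.coe_smul]
  module

/-- The alternation of `d` in its last two arguments. -/
theorem d_alternation (ξ η ζ τ : S.V) :
    (1 / 2 : ℝ) • (S.d ξ η ζ τ - S.d ξ η τ ζ) = -S.b ξ η (S.a ζ τ) := by
  have hact := S.isLocalAction_act
  have hb : S.b ξ η (S.a ζ τ) = _ := webB_actLaw_zero hact S.contDiffAt_point S.point_zero
    S.actField_act_section ξ η (S.a ζ τ)
  have ha : S.a ζ τ = _ := webA_actLaw_zero hact S.contDiffAt_point S.point_zero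
    S.actField_act_section ζ τ
  rw [S.fderiv_point.1] at hb ha
  set w := sectionSnd S.G S.point ξ η with hw
  set A : E := w - (complProj S.V S.h S.isCompl w : E) with hA
  have hA0 : actField S.act 0 A = 0 := by
    rw [S.actField_act_zero, hA, map_sub, complProj_coe, sub_self]
  have hB0 : actField S.act 0 (S.G.bracketL ζ τ
      - (complProj S.V S.h S.isCompl (S.G.bracketL ζ τ) : E)) = 0 := by
    rw [S.actField_act_zero, map_sub, complProj_coe, sub_self]
  -- In the difference the terms with an inner projection cancel, and Jacobi turns the rest into
  -- `Π[A,[τ,ζ]]`. As `A` and `[ζ,τ] - Π[ζ,τ]` are both isotropic, `hz` allows `[ζ,τ]` to be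
  -- replaced by `Π[ζ,τ] = -2a(ζ,τ)`.
  have hJ := hact.actField_jacobi (ζ : E) (τ : E) A
  have hz := hact.actField_bracketL_eq_zero hA0 hB0
  rw [S.actField_act_zero] at hb ha hJ hz
  rw [S.d_eq_complProj ξ η ζ τ hA, S.d_eq_complProj ξ η τ ζ hA, hb, ha]
  change _ = - -complProj S.V S.h S.isCompl (S.G.bracketL A
    ((-((1 / 2 : ℝ) • complProj S.V S.h S.isCompl (S.G.bracketL ζ τ)) : S.V) : E))
  rw [S.G.bracketL_swap (τ : E) (ζ : E)] at hJ
  simp only [map_sub, map_neg, map_smul, sub_apply, Submodule.coe_neg, Submodule.coe_smul]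
    at hJ hz ⊢
  linear_combination (norm := skip) (1 / 2 : ℝ) • hJ - (1 / 2 : ℝ) • hz
  module

end LoopInGroup

theorem mainTheorem2 {E : Type*} [NormedAddCommGroup E] [NormedSpace ℝ E] [FiniteDimensional ℝ E]
    (S : LoopInGroup E) :
    (∀ᶠ p in 𝓝 (0 : S.V × S.V), ContDiffAt ℝ ∞ S.law p) ∧
    (∀ ξ η ζ τ : S.V,
      (S.d ξ η ζ τ : E) =
        (1 / 2 : ℝ) • S.Pr (S.br τ (S.br (S.br ξ η) ζ))
        - (1 / 2 : ℝ) • S.Pr (S.br τ (S.Pr (S.br (S.br ξ η) ζ)))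
        - (1 / 2 : ℝ) • S.Pr (S.br τ (S.br (S.Pr (S.br ξ η)) ζ))
        + (1 / 2 : ℝ) • S.Pr (S.br τ (S.Pr (S.br (S.Pr (S.br ξ η)) ζ)))
        - (1 / 2 : ℝ) • S.Pr (S.br (S.Pr (S.br τ (S.br ξ η))) ζ)
        + (1 / 2 : ℝ) • S.Pr (S.br (S.Pr (S.br τ (S.Pr (S.br ξ η)))) ζ)
        + (2 : ℝ) • S.Pr (S.br τ (S.br (S.R ξ η) ζ))
        - (2 : ℝ) • S.Pr (S.br τ (S.Pr (S.br (S.R ξ η) ζ)))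
        - (2 : ℝ) • S.Pr (S.br (S.Pr (S.br τ (S.R ξ η))) ζ)) ∧
    (∀ ξ η ζ τ : S.V,
      HasDerivAt (fun t : ℝ => S.bConj (S.exp (t • (τ : E))) ξ η ζ) (S.d ξ η ζ τ) 0) ∧
    (∀ ξ η ζ τ : S.V,
      (1 / 2 : ℝ) • (S.d ξ η ζ τ - S.d ξ η τ ζ) = -S.b ξ η (S.a ζ τ)) := by
  refine ⟨?_, S.d_formula, S.hasDerivAt_bConj, S.d_alternation⟩
  rw [S.law_eq_actLaw]
  exact eventually_contDiffAt_actLaw S.isLocalAction_act S.contDiffAt_point S.point_zero
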